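/- Work in bounded continuous first-order logic: an $L$-structure is a nonempty complete metric space of diameter at most $1$ with interpretations of the function symbols and of the $[0,1]$-valued predicate symbols of $L$ that respect the moduli of uniform continuity prescribed by $L$; formulas take values in $[0,1]$ and are built from atomic formulas (including the metric) with arbitrary continuous connectives $[0,1]^k\to[0,1]$ and the quantifiers $\sup$ and $\inf$. Write $M\subseteq N$ if $M$ embeds in $N$ by an isometric map preserving all symbols (all inclusions are understood up to such an embedding, along which parameters of $M$ are viewed in $N$), and $M\preceq N$ if in addition the values of all formulas at tuples from $M$ agree in $M$ and $N$. A class of $L$-structures is *inductive* if it contains $\overline{\bigcup_i M_i}$ (and every structure isomorphic to it) for every nonempty chain $(M_i)$ of its members. Let $\mathcal K$ be an inductive class of $L$-structures. A restricted $L_M$-sentence in prenex normal form is a block of quantifiers $\sup,\inf$ followed by a quantifier-free formula with parameters from $M$ built using only the connectives $0$, $1$, $x/2$ and $\max(x-y,0)$. For $M\in\mathcal K$, such a sentence $\sigma$, and $r\in[0,1]$, define the forcing relations recursively (all thresholds $r,r'$ range over $[0,1]$): - if $\sigma$ is quantifier-free, $M\Vdash\sigma\bowtie r$ iff $\sigma^M\bowtie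 r$, for $\bowtie\in\{<,\le,>,\ge\}$; - if $\sigma=\inf_x\varphi(x)$: $M\Vdash\sigma<r$ iff $M\Vdash\varphi(a)<r$ for some $a\in M$; $M\Vdash\sigma\le r$ iff $M\Vdash\sigma<r'$ for all $r'>r$; $M\Vdash\sigma\ge r$ iff there are no $N\in\mathcal K$ with $N\supseteq M$ and $a\in N$ with $N\Vdash\varphi(a)<r$; $M\Vdash\sigma>r$ iff $M\Vdash\sigma\ge r'$ for some $r'>r$; - if $\sigma=\sup_x\varphi(x)$: $M\Vdash\sigma>r$ iff $M\Vdash\varphi(a)>r$ for some $a\in M$; $M\Vdash\sigma\ge r$ iff $M\Vdash\sigma>r'$ for all $r'<r$; $M\Vdash\sigma\le r$ iff there are no $N\in\mathcal K$ with $N\supseteq M$ and $a\in N$ with $N\Vdash\varphi(a)>r$; $M\Vdash\sigma<r$ iff $M\Vdash\sigma\le r'$ for some $r'<r$. Put $V^M(\sigma)=\inf\{r: M\Vdash\sigma<r\}$ and $v^M(\sigma)=\sup\{r: M\Vdash\sigma>r\}$ (computed in $[0,1]$, so $\inf\emptyset=1$ and $\sup\emptyset=0$). Call $M\in\mathcal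 K$ *infinitely generic* if $v^M(\sigma)=V^M(\sigma)$ for every restricted $L_M$-sentence $\sigma$ in prenex normal form, and let $\mathcal G$ be the class of infinitely generic members of $\mathcal K$. Then: 1. Every $M\in\mathcal K$ is contained in some $N\in\mathcal G$. 2. Every $M\in\mathcal G$ is existentially closed for $\mathcal K$: for every $N\in\mathcal K$ with $M\subseteq N$, every quantifier-free formula $\varphi(x,y)$ ($x$, $y$ finite tuples) and every tuple $a$ from $M$, $\inf_{c\in M}\varphi(c,a)^M=\inf_{b\in N}\varphi(b,a)^N$. 3. $\mathcal G$ is an inductive class. 4. Consider the subclasses $\mathcal C\subseteq\mathcal K$ that are model-consistent with $\mathcal K$ (every member of $\mathcal K$ is contained in a member of $\mathcal C$) and model-complete ($M\preceq N$ whenever $M,N\in\mathcal C$ and $M\subseteq N$). Then $\mathcal G$ is such a subclass, and it contains every other such subclass; in particular it is the unique maximal one. -/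

import Mathlib

open unitInterval

universe u

namespace ContLogic

/-! Bounded continuous first-order logic: metrics, predicates and formulas take values in
the unit interval `I = [0,1]`. -/

/-- A continuous signature: function symbols (constants are the `0`-ary ones) and predicate
symbols, each with a modulus of uniform continuity. -/
structure Signature : Type (u + 1) where
  Func : ℕ → Type u
  Pred : ℕ → Type u
  funcMod : ∀ {k : ℕ}, Func k → ℝ → ℝ
  predMod : ∀ {k : ℕ}, Pred k → ℝ → ℝ
  funcMod_pos : ∀ {k : ℕ} (f : Func k) (ε : ℝ), 0 < ε → 0 < funcMod f ε
  predMod_pos : ∀ {k : ℕ} (R : Pred k) (ε : ℝ), 0 < ε → 0 < predMod R ε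

/-- A metric structure: a nonempty complete metric space of diameter at most `1`, with
interpretations of the symbols that obey the moduli of the signature. Tuples `Fin k → M` carry
the maximum metric. -/
structure Str (L : Signature.{u}) : Type (u + 1) where
  Carrier : Type u
  [metric : MetricSpace Carrier]
  [complete : CompleteSpace Carrier]
  [nonempty : Nonempty Carrier]
  dist_le_one : ∀ x y : Carrier, dist x y ≤ 1
  func : ∀ {k : ℕ}, L.Func k → (Fin k → Carrier) → Carrier
  pred : ∀ {k : ℕ}, L.Pred k → (Fin k → Carrier) → I
  func_unif : ∀ {k : ℕ} (f : L.Func k) (ε : ℝ), 0 < ε → ∀ x y : Fin k → Carrier,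
    dist x y < L.funcMod f ε → dist (func f x) (func f y) ≤ ε
  pred_unif : ∀ {k : ℕ} (R : L.Pred k) (ε : ℝ), 0 < ε → ∀ x y : Fin k → Carrier,
    dist x y < L.predMod R ε → |(pred R x : ℝ) - (pred R y : ℝ)| ≤ ε

instance (L : Signature.{u}) : CoeSort (Str L) (Type u) := ⟨Str.Carrier⟩

instance {L : Signature.{u}} (M : Str L) : MetricSpace M := M.metric

instance {L : Signature.{u}} (M : Str L) : CompleteSpace M := M.complete

instance {L : Signature.{u}} (M : Str L) : Nonempty M := M.nonempty

variable {L : Signature.{u}}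

/-- Embeddings: isometric maps that preserve the interpretation of every symbol. `M ⊆ N` is
always understood up to such an embedding. -/
structure Emb (M N : Str L) : Type u where
  toFun : M → N
  isometry : Isometry toFun
  map_func : ∀ {k : ℕ} (f : L.Func k) (x : Fin k → M),
    toFun (M.func f x) = N.func f (toFun ∘ x)
  map_pred : ∀ {k : ℕ} (R : L.Pred k) (x : Fin k → M), N.pred R (toFun ∘ x) = M.pred R x

instance (M N : Str L) : CoeFun (Emb M N) (fun _ => M → N) := ⟨Emb.toFun⟩

/-! ### Terms and formulas -/

/-- Terms in the variables `x₀, …, x_{n-1}`. -/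
inductive Term (L : Signature.{u}) (n : ℕ) : Type u
  | var (i : Fin n) : Term L n
  | app {k : ℕ} (f : L.Func k) (ts : Fin k → Term L n) : Term L n

/-- Formulas with free variables among `x₀, …, x_{n-1}`. The connectives are all continuous
functions `[0,1]^k → [0,1]`; the quantifiers `inf` and `sup` bind the last variable. -/
inductive Formula (L : Signature.{u}) : ℕ → Type u
  | dist {n : ℕ} (s t : Term L n) : Formula L n
  | pred {n k : ℕ} (R : L.Pred k) (ts : Fin k → Term L n) : Formula L n
  | conn {n k : ℕ} (c : C(Fin k → I, I)) (φ : Fin k → Formula L n) : Formula L n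
  | inf {n : ℕ} (φ : Formula L (n + 1)) : Formula L n
  | sup {n : ℕ} (φ : Formula L (n + 1)) : Formula L n

/-- The value `t^M(a)` of a term. -/
def Term.val {n : ℕ} (M : Str L) (a : Fin n → M) : Term L n → M
  | .var i => a i
  | .app f ts => M.func f (fun i => (ts i).val M a)

/-- The value `φ(a)^M ∈ [0,1]` of a formula. -/
noncomputable def Formula.val (M : Str L) : ∀ {n : ℕ}, Formula L n → (Fin n → M) → I
  | _, .dist s t, a => ⟨Dist.dist (s.val M a) (t.val M a), dist_nonneg, M.dist_le_one _ _⟩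
  | _, .pred R ts, a => M.pred R (fun i => (ts i).val M a)
  | _, .conn c φ, a => c (fun i => (φ i).val M a)
  | _, .inf φ, a => ⨅ b : M, φ.val M (Fin.snoc a b)
  | _, .sup φ, a => ⨆ b : M, φ.val M (Fin.snoc a b)

/-- Quantifier-free formulas. -/
inductive Formula.IsQF {n : ℕ} : Formula L n → Prop
  | dist (s t : Term L n) : IsQF (.dist s t)
  | pred {k : ℕ} (R : L.Pred k) (ts : Fin k → Term L n) : IsQF (.pred R ts)
  | conn {k : ℕ} (c : C(Fin k → I, I)) (φ : Fin k → Formula L n) (h : ∀ i, IsQF (φ i)) :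
      IsQF (.conn c φ)

/-- The constant connective with value `r`. -/
def constConn (r : I) : C(Fin 0 → I, I) := ContinuousMap.const _ r

/-- The connective `x ↦ x / 2`. -/
noncomputable def halfConn : C(Fin 1 → I, I) where
  toFun x := ⟨(x 0 : ℝ) / 2, by have := (x 0).2.1; positivity,
    by have := (x 0).2.1; have := (x 0).2.2; linarith⟩
  continuous_toFun := by fun_prop

/-- Truncated subtraction `(x, y) ↦ max (x - y) 0`. -/
noncomputable def monusConn : C(Fin 2 → I, I) where
  toFun x := ⟨max ((x 0 : ℝ) - (x 1 : ℝ)) 0, le_max_right _ _,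
    max_le (by have := (x 0).2.2; have := (x 1).2.1; linarith) zero_le_one⟩
  continuous_toFun := by fun_prop

/-- Restricted quantifier-free formulas: those built from atomic formulas with the connectives
`0`, `1`, `x / 2` and `max (x - y) 0` only. -/
inductive Formula.IsRestrictedQF {n : ℕ} : Formula L n → Prop
  | dist (s t : Term L n) : IsRestrictedQF (.dist s t)
  | pred {k : ℕ} (R : L.Pred k) (ts : Fin k → Term L n) : IsRestrictedQF (.pred R ts)
  | zero (φ : Fin 0 → Formula L n) : IsRestrictedQF (.conn (constConn 0) φ)
  | one (φ : Fin 0 → Formula L n) : IsRestrictedQF (.conn (constConn 1) φ)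
  | half (φ : Fin 1 → Formula L n) (h : ∀ i, IsRestrictedQF (φ i)) :
      IsRestrictedQF (.conn halfConn φ)
  | monus (φ : Fin 2 → Formula L n) (h : ∀ i, IsRestrictedQF (φ i)) :
      IsRestrictedQF (.conn monusConn φ)

/-- Restricted formulas in prenex normal form: a block of quantifiers `inf`, `sup` in front of a
restricted quantifier-free formula. A restricted `L_M`-sentence in prenex normal form is such
a formula together with a tuple from `M` for its free variables. -/
inductive Prenex (L : Signature.{u}) : ℕ → Type u
  | qf {n : ℕ} (φ : Formula L n) (h : φ.IsRestrictedQF) : Prenex L n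
  | inf {n : ℕ} (φ : Prenex L (n + 1)) : Prenex L n
  | sup {n : ℕ} (φ : Prenex L (n + 1)) : Prenex L n

/-! ### Classes of structures -/

/-- `K` is inductive: closed under unions of (nonempty) chains, that is, every structure `M` in
which the union of a chain of substructures belonging to `K` is dense belongs to `K`. -/
def Inductive (K : Set (Str L)) : Prop :=
  ∀ (ι : Type u) [LinearOrder ι] [Nonempty ι] (S : ι → Str L) (M : Str L)
    (g : ∀ i, Emb (S i) M),
    (∀ i, S i ∈ K) → (∀ i j, i ≤ j → Set.range (g i) ⊆ Set.range (g j)) →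
    Dense (⋃ i, Set.range (g i)) → M ∈ K

/-- `f` is an elementary embedding: it preserves the values of all formulas. -/
def Emb.IsElementary {M N : Str L} (f : Emb M N) : Prop :=
  ∀ (n : ℕ) (φ : Formula L n) (a : Fin n → M), φ.val N (f ∘ a) = φ.val M a

/-- `C` is model-complete: every inclusion between members of `C` is elementary. -/
def ModelComplete (C : Set (Str L)) : Prop :=
  ∀ M ∈ C, ∀ N ∈ C, ∀ f : Emb M N, f.IsElementary

/-- `C` is model-consistent with `K`: every member of `K` is contained in a member of `C`. -/
def ModelConsistent (C K : Set (Str L)) : Prop :=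
  ∀ M ∈ K, ∃ N ∈ C, Nonempty (Emb M N)

/-- `M` is existentially closed in `N` (along the inclusion `f`): quantifier-free formulas
`φ(a, x)` with a tuple `a` from `M` have the same infimum over tuples `x` from `M` and from `N`. -/
def ExistentiallyClosedIn {M N : Str L} (f : Emb M N) : Prop :=
  ∀ (n m : ℕ) (φ : Formula L (n + m)), φ.IsQF → ∀ a : Fin n → M,
    ⨅ c : Fin m → M, φ.val M (Fin.append a c) = ⨅ b : Fin m → N, φ.val N (Fin.append (f ∘ a) b)

/-- `M` is an existentially closed member of `K`. -/
def IsEC (K : Set (Str L)) (M : Str L) : Prop :=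
  M ∈ K ∧ ∀ N ∈ K, ∀ f : Emb M N, ExistentiallyClosedIn f

/-! ### Infinite forcing -/

/-- The relation symbols `<, ≤, >, ≥`. -/
inductive Rel | lt | le | gt | ge

/-- The comparison `s ⋈ r`. -/
def Rel.holds : Rel → I → I → Prop
  | .lt, s, r => s < r
  | .le, s, r => s ≤ r
  | .gt, s, r => r < s
  | .ge, s, r => r ≤ s

/-- Infinite forcing `M ⊩ p(a) ⋈ r` relative to the class `K`. Each clause that refers back to
another relation for the same quantified sentence is written with that relation unfolded. -/
def Forces (K : Set (Str L)) : ∀ {n : ℕ}, Prenex L n → ∀ M : Str L, (Fin n → M) → Rel → I → Prop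
  | _, .qf φ _, M, a, c, r => c.holds (φ.val M a) r
  | _, .inf φ, M, a, .lt, r => ∃ b : M, Forces K φ M (Fin.snoc a b) .lt r
  | _, .inf φ, M, a, .le, r => ∀ r' : I, r < r' → ∃ b : M, Forces K φ M (Fin.snoc a b) .lt r'
  | _, .inf φ, M, a, .ge, r =>
      ¬ ∃ N ∈ K, ∃ (f : Emb M N) (b : N), Forces K φ N (Fin.snoc (f ∘ a) b) .lt r
  | _, .inf φ, M, a, .gt, r => ∃ r' : I, r < r' ∧
      ¬ ∃ N ∈ K, ∃ (f : Emb M N) (b : N), Forces K φ N (Fin.snoc (f ∘ a) b) .lt r'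
  | _, .sup φ, M, a, .le, r =>
      ¬ ∃ N ∈ K, ∃ (f : Emb M N) (b : N), Forces K φ N (Fin.snoc (f ∘ a) b) .gt r
  | _, .sup φ, M, a, .lt, r => ∃ r' : I, r' < r ∧
      ¬ ∃ N ∈ K, ∃ (f : Emb M N) (b : N), Forces K φ N (Fin.snoc (f ∘ a) b) .gt r'
  | _, .sup φ, M, a, .gt, r => ∃ b : M, Forces K φ M (Fin.snoc a b) .gt r
  | _, .sup φ, M, a, .ge, r => ∀ r' : I, r' < r → ∃ b : M, Forces K φ M (Fin.snoc a b) .gt r'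

/-- The upper forcing value `V^M(p)`, an infimum in `[0,1]` (so `inf ∅ = 1`). -/
noncomputable def upperValue (K : Set (Str L)) {n : ℕ} (p : Prenex L n) (M : Str L)
    (a : Fin n → M) : I :=
  sInf {r : I | Forces K p M a .lt r}

/-- The lower forcing value `v^M(p)`, a supremum in `[0,1]` (so `sup ∅ = 0`). -/
noncomputable def lowerValue (K : Set (Str L)) {n : ℕ} (p : Prenex L n) (M : Str L)
    (a : Fin n → M) : I :=
  sSup {r : I | Forces K p M a .gt r}

/-- The class of infinitely generic members of `K`. -/
def InfGeneric (K : Set (Str L)) : Set (Str L) :=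
  {M | M ∈ K ∧ ∀ (n : ℕ) (p : Prenex L n) (a : Fin n → M),
    lowerValue K p M a = upperValue K p M a}

/-- `C` is a subclass of `K` that is model-consistent with `K` and model-complete. -/
def IsModelCompleteSubclass (K C : Set (Str L)) : Prop :=
  C ⊆ K ∧ ModelConsistent C K ∧ ModelComplete C

end ContLogic

namespace ContLogic

variable {L : Signature.{u}}

open Filter Topology

/-! ### Embeddings -/

/-! Three facts about forced strict inequalities carry the proof. They persist under embeddings
(`Forces.lt_gt_emb`); inside the class they are never contradictory (`Forces.not_lt_and_gt`); and
for `r < r'` some extension in the class forces `< r'` or `> r` (`exists_emb_forces`), because the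
failure of every extension to produce a witness is itself what the negative clause asks for. A
structure is generic exactly when it already decides all such comparisons (`Decides`,
`decides_iff`).

Forcing is uniformly continuous in the parameters, with a modulus common to all structures
(`Forces.uniform`), so deciding comparisons over a dense set of parameters suffices. Hence unions of
chains of generic structures are generic. For existence, Zorn's lemma gives an extension deciding
every comparison over a given structure (`exists_decides`), and the union of ω iterations of this
step is generic.

In a generic structure forcing values are truth values (`upperValue_eq_val`). Along an embedding the
upper value can only fall and the lower one only rise; if both ends are generic, neither moves. This
preserves restricted prenex formulas, which are uniformly dense among all formulas by a lattice form
of Stone–Weierstrass and by moving quantifiers through monotone connectives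
(`Formula.exists_prenex`). So the generic class is model-complete. Existential closedness is
persistence and consistency applied to a block of infima.

Conversely, in a model-consistent, model-complete subclass forcing is truth: an extension refuting a
true bound would embed in a member of the subclass, where elementarity forbids it
(`IsModelCompleteSubclass.forces_iff`). Truth decides every comparison, so such a subclass consists
of generic structures. -/

/-- The identity embedding. -/
def Emb.refl (M : Str L) : Emb M M where
  toFun := id
  isometry := isometry_id
  map_func _ _ := rfl
  map_pred _ _ := rfl

/-- Composition of embeddings. -/
def Emb.comp {M N P : Str L} (g : Emb N P) (f : Emb M N) : Emb M P where
  toFun := g ∘ f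
  isometry := g.isometry.comp f.isometry
  map_func h x := by simp [f.map_func, g.map_func, Function.comp_assoc]
  map_pred R x := by rw [Function.comp_assoc, g.map_pred, f.map_pred]

@[simp] theorem Emb.coe_comp {M N P : Str L} (g : Emb N P) (f : Emb M N) :
    (g.comp f : M → P) = g ∘ f := rfl

theorem Emb.dist_comp {M N : Str L} (f : Emb M N) {n : ℕ} (a b : Fin n → M) :
    dist (f ∘ a) (f ∘ b) = dist a b := by
  simp [dist_pi_def, f.isometry.nndist_eq]

theorem Term.val_emb {M N : Str L} (f : Emb M N) {n : ℕ} (t : Term L n) (a : Fin n → M) :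
    t.val N (f ∘ a) = f (t.val M a) := by
  induction t with
  | var i => rfl
  | app g ts ih =>
    simp only [Term.val, f.map_func]
    congr 1
    funext i
    exact ih i

theorem Formula.IsQF.val_emb {M N : Str L} (f : Emb M N) {n : ℕ} {φ : Formula L n}
    (h : φ.IsQF) (a : Fin n → M) : φ.val N (f ∘ a) = φ.val M a := by
  induction h with
  | dist s t => simp [Formula.val, Term.val_emb, f.isometry.dist_eq]
  | pred R ts =>
    simp only [Formula.val, Term.val_emb]
    exact f.map_pred R _
  | conn c φ h ih => simp [Formula.val, ih]

theorem Formula.IsRestrictedQF.isQF {n : ℕ} {φ : Formula L n} (h : φ.IsRestrictedQF) :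
    φ.IsQF := by
  induction h with
  | dist s t => exact .dist s t
  | pred R ts => exact .pred R ts
  | zero φ => exact .conn _ _ (fun i => i.elim0)
  | one φ => exact .conn _ _ (fun i => i.elim0)
  | half φ h ih => exact .conn _ _ ih
  | monus φ h ih => exact .conn _ _ ih

/-! ### Uniform continuity -/

/-- The modulus comes from the signature, so one `δ` serves all structures. Phrasing it as
"eventually as `δ → 0+`" lets finitely many subterms be treated at once. -/
theorem Term.uniform {n : ℕ} (t : Term L n) {ε : ℝ} (hε : 0 < ε) :
    ∀ᶠ δ in 𝓝[>] (0 : ℝ), ∀ (M : Str L) (a b : Fin n → M), dist a b < δ →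
      dist (t.val M a) (t.val M b) ≤ ε := by
  induction t generalizing ε with
  | var i =>
    filter_upwards [Ioo_mem_nhdsGT hε] with δ hδ M a b hab
    exact (dist_le_pi_dist a b i).trans (hab.trans hδ.2).le
  | app g ts ih =>
    have hm := L.funcMod_pos g ε hε
    filter_upwards [eventually_all.2 fun i => ih i (half_pos hm)] with δ hδ M a b hab
    refine M.func_unif g ε hε _ _ (lt_of_le_of_lt ?_ (half_lt_self hm))
    exact (dist_pi_le_iff (half_pos hm).le).2 fun i => hδ i M a b hab

theorem Formula.IsQF.uniform {n : ℕ} {φ : Formula L n} (h : φ.IsQF) {ε : ℝ} (hε : 0 < ε) :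
    ∀ᶠ δ in 𝓝[>] (0 : ℝ), ∀ (M : Str L) (a b : Fin n → M), Dist.dist a b < δ →
      Dist.dist (φ.val M a) (φ.val M b) ≤ ε := by
  induction h generalizing ε with
  | dist s t =>
    filter_upwards [s.uniform (half_pos hε), t.uniform (half_pos hε)] with δ hs ht M a b hab
    have := dist_dist_dist_le (s.val M a) (t.val M a) (s.val M b) (t.val M b)
    have h1 := hs M a b hab
    have h2 := ht M a b hab
    rw [Subtype.dist_eq]
    simp only [Formula.val]
    linarith
  | pred R ts =>
    have hm := L.predMod_pos R ε hε
    filter_upwards [eventually_all.2 fun i => (ts i).uniform (half_pos hm)] with δ hδ M a b hab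
    refine M.pred_unif R ε hε _ _ (lt_of_le_of_lt ?_ (half_lt_self hm))
    exact (dist_pi_le_iff (half_pos hm).le).2 fun i => hδ i M a b hab
  | conn c φ h ih =>
    obtain ⟨η, hη, hc⟩ := Metric.uniformContinuous_iff.1
      (CompactSpace.uniformContinuous_of_continuous c.continuous) ε hε
    filter_upwards [eventually_all.2 fun i => ih i (half_pos hη)] with δ hδ M a b hab
    refine (hc (lt_of_le_of_lt ?_ (half_lt_self hη))).le
    exact (dist_pi_le_iff (half_pos hη).le).2 fun i => hδ i M a b hab

theorem dist_snoc_le {X : Type*} [PseudoMetricSpace X] {n : ℕ} (a b : Fin n → X) (c : X) :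
    dist (Fin.snoc a c : Fin (n + 1) → X) (Fin.snoc b c) ≤ dist a b := by
  refine (dist_pi_le_iff dist_nonneg).2 fun i => ?_
  induction i using Fin.lastCases with
  | last => simp
  | cast i => simpa using dist_le_pi_dist a b i

/-! ### Forcing -/

variable {K : Set (Str L)}

theorem Forces.lt_mono {n : ℕ} {p : Prenex L n} {M : Str L} {a : Fin n → M} {r r' : I}
    (h : Forces K p M a .lt r) (hr : r ≤ r') : Forces K p M a .lt r' := by
  induction p with
  | qf φ hφ => exact lt_of_lt_of_le (b := r) h hr
  | inf φ ih =>
    obtain ⟨b, hb⟩ := h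
    exact ⟨b, ih hb⟩
  | sup φ ih =>
    obtain ⟨s, hs, h⟩ := h
    exact ⟨s, hs.trans_le hr, h⟩

theorem Forces.gt_mono {n : ℕ} {p : Prenex L n} {M : Str L} {a : Fin n → M} {r r' : I}
    (h : Forces K p M a .gt r) (hr : r' ≤ r) : Forces K p M a .gt r' := by
  induction p with
  | qf φ hφ => exact lt_of_le_of_lt (b := r) hr h
  | sup φ ih =>
    obtain ⟨b, hb⟩ := h
    exact ⟨b, ih hb⟩
  | inf φ ih =>
    obtain ⟨s, hs, h⟩ := h
    exact ⟨s, hr.trans_lt hs, h⟩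

/-- Witnesses are carried along `f`. The negative clauses quantify over all extensions, and an
extension of `N` is an extension of `M` by composition. -/
theorem Forces.lt_gt_emb {n : ℕ} (p : Prenex L n) {M N : Str L} (f : Emb M N) (a : Fin n → M)
    (r : I) : (Forces K p M a .lt r → Forces K p N (f ∘ a) .lt r) ∧
      (Forces K p M a .gt r → Forces K p N (f ∘ a) .gt r) := by
  induction p with
  | qf φ hφ =>
    simp only [Forces, Rel.holds, hφ.isQF.val_emb f a]
    exact ⟨id, id⟩
  | inf φ ih =>
    constructor
    · rintro ⟨b, hb⟩
      refine ⟨f b, ?_⟩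
      rw [← Fin.comp_snoc]
      exact (ih _).1 hb
    · rintro ⟨s, hs, h⟩
      refine ⟨s, hs, ?_⟩
      rintro ⟨P, hP, g, b, hb⟩
      exact h ⟨P, hP, g.comp f, b, hb⟩
  | sup φ ih =>
    constructor
    · rintro ⟨s, hs, h⟩
      refine ⟨s, hs, ?_⟩
      rintro ⟨P, hP, g, b, hb⟩
      exact h ⟨P, hP, g.comp f, b, hb⟩
    · rintro ⟨b, hb⟩
      refine ⟨f b, ?_⟩
      rw [← Fin.comp_snoc]
      exact (ih _).2 hb

theorem Forces.lt_emb {n : ℕ} {p : Prenex L n} {M N : Str L} (f : Emb M N) {a : Fin n → M}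
    {r : I} (h : Forces K p M a .lt r) : Forces K p N (f ∘ a) .lt r :=
  (Forces.lt_gt_emb p f a r).1 h

theorem Forces.gt_emb {n : ℕ} {p : Prenex L n} {M N : Str L} (f : Emb M N) {a : Fin n → M}
    {r : I} (h : Forces K p M a .gt r) : Forces K p N (f ∘ a) .gt r :=
  (Forces.lt_gt_emb p f a r).2 h

/-- One of the two sides supplies a witness in `M`, and `M`, as an extension of itself in `K`,
violates the negative clause of the other. -/
theorem Forces.not_lt_and_gt {n : ℕ} {p : Prenex L n} {M : Str L} (hM : M ∈ K) {a : Fin n → M}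
    {r : I} (h : Forces K p M a .lt r) (h' : Forces K p M a .gt r) : False := by
  cases p with
  | qf φ hφ => exact lt_asymm (a := r) h' h
  | inf φ =>
    obtain ⟨b, hb⟩ := h
    obtain ⟨s, hs, h'⟩ := h'
    exact h' ⟨M, hM, Emb.refl M, b, hb.lt_mono hs.le⟩
  | sup φ =>
    obtain ⟨b, hb⟩ := h'
    obtain ⟨s, hs, h⟩ := h
    exact h ⟨M, hM, Emb.refl M, b, hb.gt_mono hs.le⟩

theorem Forces.lt_of_gt_of_lt {n : ℕ} {p : Prenex L n} {M : Str L} (hM : M ∈ K) {a : Fin n → M}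
    {r s : I} (h : Forces K p M a .gt r) (h' : Forces K p M a .lt s) : r < s :=
  lt_of_not_ge fun hsr => (h'.lt_mono hsr).not_lt_and_gt hM h

/-- Every structure of the class extends to one that decides a given comparison. -/
theorem exists_emb_forces {n : ℕ} (p : Prenex L n) {M : Str L} (hM : M ∈ K) (a : Fin n → M)
    {r r' : I} (hr : r < r') : ∃ N ∈ K, ∃ f : Emb M N,
      Forces K p N (f ∘ a) .lt r' ∨ Forces K p N (f ∘ a) .gt r := by
  cases p with
  | qf φ hφ =>
    refine ⟨M, hM, Emb.refl M, ?_⟩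
    exact (lt_or_ge (φ.val M a) r').imp id fun h => hr.trans_le h
  | inf φ =>
    by_cases h : ∃ N ∈ K, ∃ (f : Emb M N) (b : N), Forces K φ N (Fin.snoc (f ∘ a) b) .lt r'
    · obtain ⟨N, hN, f, b, hb⟩ := h
      exact ⟨N, hN, f, .inl ⟨b, hb⟩⟩
    -- That no extension forces `< r'` is the clause for `≥ r'`, and `r < r'` makes it `> r`.
    · exact ⟨M, hM, Emb.refl M, .inr ⟨r', hr, h⟩⟩
  | sup φ =>
    by_cases h : ∃ N ∈ K, ∃ (f : Emb M N) (b : N), Forces K φ N (Fin.snoc (f ∘ a) b) .gt r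
    · obtain ⟨N, hN, f, b, hb⟩ := h
      exact ⟨N, hN, f, .inr ⟨b, hb⟩⟩
    · exact ⟨M, hM, Emb.refl M, .inl ⟨r, hr, h⟩⟩

/-- Forcing is uniformly continuous in the parameters. -/
theorem Forces.uniform (K : Set (Str L)) {n : ℕ} (p : Prenex L n) {ε : ℝ} (hε : 0 < ε) :
    ∀ᶠ δ in 𝓝[>] (0 : ℝ), ∀ (M : Str L) (a b : Fin n → M), dist a b < δ → ∀ r r' : I,
      (r : ℝ) + ε ≤ r' → (Forces K p M a .lt r → Forces K p M b .lt r') ∧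
        (Forces K p M a .gt r' → Forces K p M b .gt r) := by
  induction p with
  | qf φ hφ =>
    filter_upwards [hφ.isQF.uniform hε] with δ hδ M a b hab r r' hr
    have := hδ M a b hab
    rw [Subtype.dist_eq, Real.dist_eq, abs_le] at this
    simp only [Forces, Rel.holds, ← Subtype.coe_lt_coe]
    constructor <;> intro h <;> linarith
  | inf φ ih =>
    filter_upwards [ih] with δ hδ M a b hab r r' hr
    constructor
    · rintro ⟨c, hc⟩
      exact ⟨c, (hδ M _ _ ((dist_snoc_le a b c).trans_lt hab) r r' hr).1 hc⟩
    · rintro ⟨s, hs, h⟩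
      have hs' : (r' : ℝ) < s := hs
      -- The threshold drops by `ε`: an extension with `φ(b, c) < s - ε` would have `φ(a, c) < s`,
      -- since embeddings keep the distance of `a` and `b` below `δ`. A modulus valid in all
      -- extensions is needed here.
      refine ⟨⟨s - ε, ?_, ?_⟩, ?_, ?_⟩
      · have := r.2.1
        linarith
      · have := s.2.2
        linarith
      · rw [← Subtype.coe_lt_coe]
        show (r : ℝ) < s - ε
        linarith
      · rintro ⟨N, hN, f, c, hc⟩
        refine h ⟨N, hN, f, c, (hδ N _ _ ((dist_snoc_le _ _ c).trans_lt ?_) _ s ?_).1 hc⟩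
        · rwa [f.dist_comp, dist_comm]
        · simp
  | sup φ ih =>
    filter_upwards [ih] with δ hδ M a b hab r r' hr
    constructor
    · rintro ⟨s, hs, h⟩
      have hs' : (s : ℝ) < r := hs
      refine ⟨⟨s + ε, ?_, ?_⟩, ?_, ?_⟩
      · have := s.2.1
        linarith
      · have := r'.2.2
        linarith
      · rw [← Subtype.coe_lt_coe]
        show (s : ℝ) + ε < r'
        linarith
      · rintro ⟨N, hN, f, c, hc⟩
        refine h ⟨N, hN, f, c, (hδ N _ _ ((dist_snoc_le _ _ c).trans_lt ?_) s _ ?_).2 hc⟩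
        · rwa [f.dist_comp, dist_comm]
        · simp
    · rintro ⟨c, hc⟩
      exact ⟨c, (hδ M _ _ ((dist_snoc_le a b c).trans_lt hab) r r' hr).2 hc⟩

/-- `M` decides `p(a)`, up to an arbitrarily small error. -/
def Decides (K : Set (Str L)) {n : ℕ} (p : Prenex L n) (M : Str L) (a : Fin n → M) : Prop :=
  ∀ r r' : I, r < r' → Forces K p M a .lt r' ∨ Forces K p M a .gt r

theorem lowerValue_le_upperValue {n : ℕ} (p : Prenex L n) {M : Str L} (hM : M ∈ K)
    (a : Fin n → M) : lowerValue K p M a ≤ upperValue K p M a :=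
  sSup_le fun _ hr => le_sInf fun _ hs => (Forces.lt_of_gt_of_lt hM hr hs).le

theorem upperValue_lt_iff {n : ℕ} {p : Prenex L n} {M : Str L} {a : Fin n → M} {r : I} :
    upperValue K p M a < r ↔ ∃ s < r, Forces K p M a .lt s := by
  rw [upperValue, sInf_lt_iff]
  exact exists_congr fun s => and_comm

theorem lt_lowerValue_iff {n : ℕ} {p : Prenex L n} {M : Str L} {a : Fin n → M} {r : I} :
    r < lowerValue K p M a ↔ ∃ s, r < s ∧ Forces K p M a .gt s := by
  rw [lowerValue, lt_sSup_iff]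
  exact exists_congr fun s => and_comm

/-- A gap between the two values would contain a pair `r < r'` strictly inside it, and deciding that
pair contradicts the definition of one of the values. -/
theorem decides_iff {n : ℕ} (p : Prenex L n) {M : Str L} (hM : M ∈ K) (a : Fin n → M) :
    Decides K p M a ↔ lowerValue K p M a = upperValue K p M a := by
  constructor
  · intro h
    refine (lowerValue_le_upperValue p hM a).antisymm (le_of_not_gt fun hlt => ?_)
    obtain ⟨r', h1, h2⟩ := exists_between hlt
    obtain ⟨r, h3, h4⟩ := exists_between h1
    rcases h r r' h4 with h | h
    · exact h2.not_ge (sInf_le h)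
    · exact h3.not_ge (le_sSup h)
  · intro h r r' hr
    rcases lt_or_ge (upperValue K p M a) r' with h1 | h1
    · obtain ⟨s, hs, h2⟩ := upperValue_lt_iff.1 h1
      exact .inl (h2.lt_mono hs.le)
    · obtain ⟨s, hs, h2⟩ := lt_lowerValue_iff.1 (h.symm ▸ hr.trans_le h1)
      exact .inr (h2.gt_mono hs.le)

theorem Decides.emb {n : ℕ} {p : Prenex L n} {M N : Str L} {a : Fin n → M}
    (h : Decides K p M a) (f : Emb M N) : Decides K p N (f ∘ a) :=
  fun r r' hr => (h r r' hr).imp (Forces.lt_emb f) (Forces.gt_emb f)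

/-- Split `[r, r']` into thirds and decide the middle third at a nearby tuple; uniformity costs at
most one outer third in moving to `a`. -/
theorem decides_of_approx {n : ℕ} {p : Prenex L n} {M : Str L} {a : Fin n → M}
    (h : ∀ δ > 0, ∃ b : Fin n → M, dist b a < δ ∧ Decides K p M b) : Decides K p M a := by
  intro r r' hr
  have hr' : (r : ℝ) < r' := hr
  have h0 := r.2.1
  have h1 := r'.2.2
  have hε : 0 < ((r' : ℝ) - r) / 3 := by linarith
  obtain ⟨δ, hδ, hδ0⟩ := ((Forces.uniform K p hε).and self_mem_nhdsWithin).exists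
  obtain ⟨b, hb, hd⟩ := h δ hδ0
  have hs : (r : ℝ) + (r' - r) / 3 ∈ I := ⟨by linarith, by linarith⟩
  have hs' : (r' : ℝ) - (r' - r) / 3 ∈ I := ⟨by linarith, by linarith⟩
  refine (hd ⟨_, hs⟩ ⟨_, hs'⟩ (Subtype.coe_lt_coe.1 ?_)).imp (fun h => ?_) fun h => ?_
  · show (r : ℝ) + (r' - r) / 3 < r' - (r' - r) / 3
    linarith
  · exact (hδ M b a hb _ _ (by simp)).1 h
  · exact (hδ M b a hb _ _ (by simp)).2 h

theorem mem_infGeneric_iff {M : Str L} : M ∈ InfGeneric K ↔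
    M ∈ K ∧ ∀ (n : ℕ) (p : Prenex L n) (a : Fin n → M), Decides K p M a :=
  and_congr_right fun hM => forall_congr' fun _ => forall_congr' fun p => forall_congr' fun a =>
    (decides_iff p hM a).symm

/-- A finite tuple in the closure of the union of a chain is approximated by tuples from members
of the chain. -/
theorem exists_tuple_dist_lt {ι X : Type*} [LinearOrder ι] [Nonempty ι] [PseudoMetricSpace X]
    {Y : ι → Type*} (g : ∀ i, Y i → X) (hg : ∀ i j, i ≤ j → Set.range (g i) ⊆ Set.range (g j))
    (hd : Dense (⋃ i, Set.range (g i))) {n : ℕ} (a : Fin n → X) {δ : ℝ} (hδ : 0 < δ) :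
    ∃ (i : ι) (b : Fin n → Y i), dist (g i ∘ b) a < δ := by
  have h : ∀ k, ∃ i, ∃ y : Y i, dist (g i y) (a k) < δ := fun k => by
    obtain ⟨x, hx, hxa⟩ := Metric.dense_iff.1 hd (a k) δ hδ
    obtain ⟨i, y, rfl⟩ := Set.mem_iUnion.1 hxa
    exact ⟨i, y, hx⟩
  choose i y hy using h
  obtain ⟨j, hj⟩ := Finite.exists_le i
  choose b hb using fun k => hg _ _ (hj k) ⟨y k, rfl⟩
  refine ⟨j, b, (dist_pi_lt_iff hδ).2 fun k => ?_⟩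
  rw [Function.comp_apply, hb]
  exact hy k

/-- The comparisons need to be decided in `M` only, not in the stage of their parameters. This
covers both chains of generic structures and chains whose next stage decides the previous one. -/
theorem mem_infGeneric_of_dense {ι : Type*} [LinearOrder ι] [Nonempty ι] {S : ι → Str L}
    {M : Str L} (hM : M ∈ K) (g : ∀ i, Emb (S i) M)
    (hg : ∀ i j, i ≤ j → Set.range (g i) ⊆ Set.range (g j))
    (hd : Dense (⋃ i, Set.range (g i)))
    (h : ∀ i (n : ℕ) (p : Prenex L n) (a : Fin n → S i), Decides K p M (g i ∘ a)) :
    M ∈ InfGeneric K := by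
  refine mem_infGeneric_iff.2 ⟨hM, fun n p a => decides_of_approx fun δ hδ => ?_⟩
  obtain ⟨i, b, hb⟩ := exists_tuple_dist_lt (fun i => (g i : S i → M)) hg hd a hδ
  exact ⟨_, hb, h i n p b⟩

theorem inductive_infGeneric (hK : Inductive K) : Inductive (InfGeneric K) := by
  intro ι _ _ S M g hS hg hd
  exact mem_infGeneric_of_dense (hK ι S M g (fun i => (hS i).1) hg hd) g hg hd fun i n p a =>
    ((mem_infGeneric_iff.1 (hS i)).2 n p a).emb (g i)

/-! ### Density of the restricted connectives -/

/-- The connective `x / 2` on points. -/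
noncomputable def halfI (x : I) : I := halfConn fun _ => x

/-- Truncated subtraction on points. -/
noncomputable def monusI (x y : I) : I := monusConn ![x, y]

theorem coe_halfI (x : I) : (halfI x : ℝ) = x / 2 := rfl

theorem coe_monusI (x y : I) : (monusI x y : ℝ) = max ((x : ℝ) - y) 0 := rfl

theorem halfConn_apply (x : Fin 1 → I) : halfConn x = halfI (x 0) := rfl

theorem monusConn_apply (x : Fin 2 → I) : monusConn x = monusI (x 0) (x 1) := rfl

theorem continuous_halfI : Continuous halfI := by
  unfold halfI
  fun_prop

theorem continuous_monusI : Continuous fun x : I × I => monusI x.1 x.2 :=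
  Continuous.subtype_mk (by fun_prop) _

/-- Sets of `[0,1]`-valued functions closed under the restricted connectives. -/
structure IsRestrictedClosed {X : Type*} (F : Set (X → I)) : Prop where
  zero : (fun _ => 0) ∈ F
  one : (fun _ => 1) ∈ F
  half : ∀ f ∈ F, (fun x => halfI (f x)) ∈ F
  monus : ∀ f ∈ F, ∀ g ∈ F, (fun x => monusI (f x) (g x)) ∈ F

/-- The functions that are uniform limits of functions in `F`. -/
def uniformClosure {X : Type*} (F : Set (X → I)) : Set (X → I) :=
  {g | ∀ ε > 0, ∃ f ∈ F, ∀ x, dist (g x) (f x) ≤ ε}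

theorem subset_uniformClosure {X : Type*} (F : Set (X → I)) : F ⊆ uniformClosure F :=
  fun f hf _ hε => ⟨f, hf, fun x => by simpa using hε.le⟩

theorem uniformClosure_idem {X : Type*} (F : Set (X → I)) :
    uniformClosure (uniformClosure F) ⊆ uniformClosure F := by
  intro h hh ε hε
  obtain ⟨g, hg, h1⟩ := hh _ (half_pos hε)
  obtain ⟨f, hf, h2⟩ := hg _ (half_pos hε)
  exact ⟨f, hf, fun x => (dist_triangle _ (g x) _).trans (by linarith [h1 x, h2 x])⟩

theorem IsRestrictedClosed.uniform {X : Type*} {F : Set (X → I)}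
    (hF : IsRestrictedClosed F) : IsRestrictedClosed (uniformClosure F) where
  zero := subset_uniformClosure F hF.zero
  one := subset_uniformClosure F hF.one
  half g hg ε hε := by
    obtain ⟨f, hf, h⟩ := hg ε hε
    refine ⟨_, hF.half f hf, fun x => ?_⟩
    have := h x
    rw [Subtype.dist_eq, Real.dist_eq, abs_le] at this ⊢
    simp only [coe_halfI]
    constructor <;> linarith
  monus g hg g' hg' ε hε := by
    obtain ⟨f, hf, h⟩ := hg _ (half_pos hε)
    obtain ⟨f', hf', h'⟩ := hg' _ (half_pos hε)
    refine ⟨_, hF.monus f hf f' hf', fun x => ?_⟩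
    have h1 := h x
    have h2 := h' x
    rw [Subtype.dist_eq, Real.dist_eq] at h1 h2 ⊢
    simp only [coe_monusI]
    refine (abs_max_sub_max_le_abs _ _ _).trans ?_
    rw [abs_le] at h1 h2 ⊢
    constructor <;> linarith

theorem IsRestrictedClosed.compl {X : Type*} {F : Set (X → I)} (hF : IsRestrictedClosed F)
    {f : X → I} (hf : f ∈ F) :
    (fun x => monusI 1 (f x)) ∈ F :=
  hF.monus _ hF.one _ hf

/-- `min x y = x ∸ (x ∸ y)`. -/
theorem IsRestrictedClosed.inf {X : Type*} {F : Set (X → I)} (hF : IsRestrictedClosed F)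
    {f g : X → I} (hf : f ∈ F) (hg : g ∈ F) :
    (fun x => f x ⊓ g x) ∈ F := by
  convert hF.monus _ hf _ (hF.monus _ hf _ hg) using 2 with x
  refine Subtype.ext ?_
  simp only [coe_monusI]
  rcases le_total (f x) (g x) with h | h
  · rw [inf_eq_left.2 h, max_eq_right (sub_nonpos.2 (show (f x : ℝ) ≤ g x from h)), sub_zero,
      max_eq_left (f x).2.1]
  · rw [inf_eq_right.2 h, max_eq_left (sub_nonneg.2 (show (g x : ℝ) ≤ f x from h)), sub_sub_cancel,
      max_eq_left (g x).2.1]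

/-- De Morgan dual of the minimum under `x ↦ 1 ∸ x`. -/
theorem IsRestrictedClosed.sup {X : Type*} {F : Set (X → I)} (hF : IsRestrictedClosed F)
    {f g : X → I} (hf : f ∈ F) (hg : g ∈ F) :
    (fun x => f x ⊔ g x) ∈ F := by
  convert hF.compl (hF.inf (hF.compl hf) (hF.compl hg)) using 2 with x
  refine Subtype.ext ?_
  have h1 := (f x).2.2
  have h2 := (g x).2.2
  have h3 := (f x).2.1
  have h4 := (g x).2.1
  have hc : ∀ y : I, (monusI 1 y : ℝ) = 1 - y := fun y => by
    rw [coe_monusI]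
    exact max_eq_left (sub_nonneg.2 y.2.2)
  rw [hc]
  rcases le_total (f x) (g x) with h | h
  · rw [sup_eq_right.2 h, inf_eq_right.2, hc, sub_sub_cancel]
    rw [← Subtype.coe_le_coe, hc, hc]
    exact sub_le_sub_left (Subtype.coe_le_coe.2 h) (1 : ℝ)
  · rw [sup_eq_left.2 h, inf_eq_left.2, hc, sub_sub_cancel]
    rw [← Subtype.coe_le_coe, hc, hc]
    exact sub_le_sub_left (Subtype.coe_le_coe.2 h) (1 : ℝ)

/-- Closure under truncated addition. -/
theorem IsRestrictedClosed.exists_add {X : Type*} {F : Set (X → I)} (hF : IsRestrictedClosed F)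
    {f g : X → I} (hf : f ∈ F) (hg : g ∈ F) :
    ∃ h ∈ F, ∀ x, (h x : ℝ) = min ((f x : ℝ) + g x) 1 := by
  -- The witness is `1 ∸ ((1 ∸ f) ∸ g)`.
  refine ⟨_, hF.compl (hF.monus _ (hF.compl hf) _ hg), fun x => ?_⟩
  have h3 := (f x).2.1
  have h4 := (g x).2.1
  simp only [coe_monusI, Set.Icc.coe_one]
  rw [max_eq_left (sub_nonneg.2 (f x).2.2)]
  rcases le_total ((f x : ℝ) + g x) 1 with h | h
  · rw [max_eq_left (a := 1 - (f x : ℝ) - g x) (by linarith), max_eq_left (by linarith),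
      min_eq_left h]
    ring
  · rw [max_eq_right (a := 1 - (f x : ℝ) - g x) (by linarith), max_eq_left (by linarith),
      min_eq_right h]
    ring

/-- Split `k` into two parts of size at most `2 ^ m` and halve both multiples before adding, so that
the sum is never truncated. -/
theorem IsRestrictedClosed.exists_dyadic_mul {X : Type*} {F : Set (X → I)} (hF : IsRestrictedClosed F)
    {f : X → I} (hf : f ∈ F) (m : ℕ) :
    ∀ k : ℕ, k ≤ 2 ^ m → ∃ h ∈ F, ∀ x, (h x : ℝ) = k / 2 ^ m * f x := by
  induction m with
  | zero =>
    intro k hk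
    interval_cases k
    · exact ⟨_, hF.zero, by simp⟩
    · exact ⟨_, hf, by simp⟩
  | succ m ih =>
    intro k hk
    rw [pow_succ] at hk
    obtain ⟨h₁, hh₁, e₁⟩ := ih (k / 2) (by omega)
    obtain ⟨h₂, hh₂, e₂⟩ := ih (k - k / 2) (by omega)
    obtain ⟨h, hh, e⟩ := hF.exists_add (hF.half _ hh₁) (hF.half _ hh₂)
    refine ⟨h, hh, fun x => ?_⟩
    rw [e, coe_halfI, coe_halfI, min_eq_left (by linarith [(h₁ x).2.2, (h₂ x).2.2]), e₁, e₂]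
    have : (k : ℝ) = (k / 2 : ℕ) + (k - k / 2 : ℕ) := by
      rw [← Nat.cast_add]
      congr 1
      omega
    rw [this, pow_succ]
    field_simp

/-- Closure under truncated addition of a function to itself. -/
theorem IsRestrictedClosed.exists_nsmul {X : Type*} {F : Set (X → I)} (hF : IsRestrictedClosed F)
    {f : X → I} (hf : f ∈ F) (n : ℕ) :
    ∃ h ∈ F, ∀ x, (h x : ℝ) = min (n * (f x : ℝ)) 1 := by
  induction n with
  | zero => exact ⟨_, hF.zero, by simp⟩
  | succ n ih =>
    obtain ⟨g, hg, e⟩ := ih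
    obtain ⟨h, hh, e'⟩ := hF.exists_add hg hf
    refine ⟨h, hh, fun x => ?_⟩
    have := (f x).2.1
    rw [e', e]
    push_cast
    rcases le_total (n * (f x : ℝ)) 1 with h | h
    · rw [min_eq_left h]
      ring_nf
    · rw [min_eq_right h, min_eq_right (by linarith), min_eq_right (by linarith)]

theorem IsRestrictedClosed.exists_mul {X : Type*} {F : Set (X → I)} (hF : IsRestrictedClosed F)
    (hc : uniformClosure F ⊆ F) {f : X → I} (hf : f ∈ F) {c : ℝ} (h0 : 0 ≤ c)
    (h1 : c ≤ 1) : ∃ h ∈ F, ∀ x, (h x : ℝ) = c * f x := by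
  refine ⟨fun x => ⟨c, h0, h1⟩ * f x, hc fun ε hε => ?_, fun x => rfl⟩
  obtain ⟨m, hm⟩ := exists_pow_lt_of_lt_one hε (show (1 / 2 : ℝ) < 1 by norm_num)
  have h2 : (0 : ℝ) < 2 ^ m := by positivity
  have hk : (⌊c * 2 ^ m⌋₊ : ℝ) ≤ c * 2 ^ m := Nat.floor_le (by positivity)
  have hk' := (Nat.lt_floor_add_one (c * 2 ^ m)).le
  obtain ⟨h, hh, e⟩ := hF.exists_dyadic_mul hf m ⌊c * 2 ^ m⌋₊ (by
    rw [← Nat.cast_le (α := ℝ)]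
    push_cast
    nlinarith)
  refine ⟨h, hh, fun x => ?_⟩
  have hx0 := (f x).2.1
  have hx1 := (f x).2.2
  rw [Subtype.dist_eq, Real.dist_eq, e]
  show |c * (f x : ℝ) - _| ≤ ε
  rw [← sub_mul, abs_mul, abs_of_nonneg hx0]
  have : |c - ⌊c * 2 ^ m⌋₊ / 2 ^ m| ≤ ε := by
    have e1 : c - ⌊c * 2 ^ m⌋₊ / 2 ^ m = (c * 2 ^ m - ⌊c * 2 ^ m⌋₊) * (1 / 2) ^ m := by
      rw [one_div, inv_pow]
      field_simp
    have h3 : (0 : ℝ) < (1 / 2) ^ m := by positivity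
    rw [e1, abs_of_nonneg (mul_nonneg (by linarith) h3.le)]
    nlinarith
  exact (mul_le_of_le_one_right (abs_nonneg _) hx1).trans this

/-- The positive and negative parts of the coefficients are divided by a large `n` to stay within
`[0,1]`. Truncated subtraction clamps at `0`, and the truncated `n`-fold sum undoes the scaling and
clamps at `1`. -/
theorem IsRestrictedClosed.clamp_affine {X : Type*} {F : Set (X → I)} (hF : IsRestrictedClosed F)
    (hc : uniformClosure F ⊆ F) {f : X → I} (hf : f ∈ F) (α β : ℝ) :
    (fun x => Set.projIcc (0 : ℝ) 1 zero_le_one (α * f x + β)) ∈ F := by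
  have key : ∀ a b : ℝ, 0 ≤ a → 0 ≤ b → a + b ≤ 1 →
      ∃ h ∈ F, ∀ x, (h x : ℝ) = a * f x + b := fun a b ha hb hab => by
    obtain ⟨h₁, hh₁, e₁⟩ := hF.exists_mul hc hf ha (by linarith)
    obtain ⟨h₂, hh₂, e₂⟩ := hF.exists_mul hc hF.one hb (by linarith)
    obtain ⟨h, hh, e⟩ := hF.exists_add hh₁ hh₂
    refine ⟨h, hh, fun x => ?_⟩
    have := mul_le_of_le_one_right ha (f x).2.2
    rw [e, e₁, e₂, Set.Icc.coe_one, mul_one, min_eq_left (by linarith)]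
  obtain ⟨n, hn⟩ := exists_nat_ge (|α| + |β| + 1)
  have hα := abs_nonneg α
  have hβ := abs_nonneg β
  have hn0 : (0 : ℝ) < n := by linarith
  have hα' := le_abs_self α
  have hβ' := le_abs_self β
  have hα'' := neg_abs_le α
  have hβ'' := neg_abs_le β
  have hα1 : max α 0 ≤ |α| := max_le hα' hα
  have hβ1 : max β 0 ≤ |β| := max_le hβ' hβ
  have hα2 : max (-α) 0 ≤ |α| := max_le (neg_le_abs α) hα
  have hβ2 : max (-β) 0 ≤ |β| := max_le (neg_le_abs β) hβ
  obtain ⟨s, hs, es⟩ := key (max α 0 / n) (max β 0 / n) (by positivity) (by positivity) (by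
    rw [← add_div, div_le_one hn0]
    linarith)
  obtain ⟨t, ht, et⟩ := key (max (-α) 0 / n) (max (-β) 0 / n) (by positivity) (by positivity) (by
    rw [← add_div, div_le_one hn0]
    linarith)
  obtain ⟨h, hh, e⟩ := hF.exists_nsmul (hF.monus _ hs _ ht) n
  convert hh using 2 with x
  refine Subtype.ext ?_
  have e3 : ∀ γ : ℝ, γ = max γ 0 - max (-γ) 0 := fun γ => by
    rcases le_total γ 0 with h | h
    · rw [max_eq_right h, max_eq_left (by linarith)]
      ring
    · rw [max_eq_left h, max_eq_right (by linarith)]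
      ring
  have e2 : (n : ℝ) * ((s x : ℝ) - t x) = α * f x + β := by
    rw [es, et]
    conv_rhs => rw [e3 α, e3 β]
    field_simp
    ring
  rw [e, coe_monusI, mul_max_of_nonneg _ _ hn0.le, e2, mul_zero, Set.coe_projIcc,
    max_min_distrib_left, max_eq_right (zero_le_one (α := ℝ)), min_comm, max_comm]

/-- Every continuous connective is a uniform limit of restricted ones. -/
theorem IsRestrictedClosed.conn {X : Type*} {F : Set (X → I)} (hF : IsRestrictedClosed F)
    (hc : uniformClosure F ⊆ F) {k : ℕ} (c : C(Fin k → I, I)) {u : Fin k → X → I}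
    (hu : ∀ i, u i ∈ F) : (fun x => c fun i => u i x) ∈ F := by
  -- Real-valued functions are used because interpolating affine functions may leave `[0,1]`;
  -- clamping brings them back and respects lattice operations, so lattice Stone–Weierstrass applies
  -- to `T`.
  let T : Set C(Fin k → I, ℝ) :=
    {g | (fun x => Set.projIcc (0 : ℝ) 1 zero_le_one (g fun i => u i x)) ∈ F}
  have hT_iff : ∀ g, g ∈ T ↔
      (fun x => Set.projIcc (0 : ℝ) 1 zero_le_one (g fun i => u i x)) ∈ F := fun _ => Iff.rfl
  have hmono := Set.monotone_projIcc (zero_le_one (α := ℝ))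
  have hT : closure T = ⊤ := by
    refine ContinuousMap.sublattice_closure_eq_top T ?_ ?_ ?_ ?_
    · refine ⟨0, (hT_iff _).2 ?_⟩
      convert hF.zero using 2 with x
      exact Set.projIcc_left _
    · intro g hg g' hg'
      rw [hT_iff]
      convert hF.inf hg hg' using 2 with x
      exact hmono.map_inf _ _
    · intro g hg g' hg'
      rw [hT_iff]
      convert hF.sup hg hg' using 2 with x
      exact hmono.map_sup _ _
    · intro v x y
      by_cases hxy : x = y
      · subst hxy
        refine ⟨.const _ (v x), (hT_iff _).2 ?_, rfl, rfl⟩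
        convert hF.clamp_affine hc hF.one 0 (v x) using 2 with z
        simp
      -- Two-point interpolation: an affine function of one coordinate in which `x` and `y` differ.
      · obtain ⟨i, hi⟩ := Function.ne_iff.1 hxy
        have hi' : ((y i : ℝ) - x i) ≠ 0 := fun h => hi (Subtype.ext (sub_eq_zero.1 h).symm)
        refine ⟨⟨fun z => (v y - v x) / (y i - x i) * (z i : ℝ) +
          (v x - (v y - v x) / (y i - x i) * x i), by fun_prop⟩, hF.clamp_affine hc (hu i) _ _,
          ?_, ?_⟩
        · simp
        · simp only [ContinuousMap.coe_mk]
          field_simp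
          ring
  have hmem : (⟨fun z => (c z : ℝ), by fun_prop⟩ : C(Fin k → I, ℝ)) ∈ closure T := by
    rw [hT]
    trivial
  refine hc fun ε hε => ?_
  obtain ⟨g, hg, hd⟩ := Metric.mem_closure_iff.1 hmem ε hε
  refine ⟨_, hg, fun x => ?_⟩
  have h1 := (ContinuousMap.dist_apply_le_dist (fun i => u i x)).trans hd.le
  rw [ContinuousMap.coe_mk, Real.dist_eq] at h1
  rw [Subtype.dist_eq, Real.dist_eq, Set.coe_projIcc]
  have h0 := (c fun i => u i x).2.1
  have h2 := (c fun i => u i x).2.2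
  generalize (c fun i => u i x : ℝ) = s at *
  generalize (g fun i => u i x : ℝ) = t at *
  rw [abs_le] at *
  rcases le_total t 0 with h | h
  · rw [min_eq_right (by linarith), max_eq_left h]
    constructor <;> linarith
  · rcases le_total t 1 with h' | h'
    · rwa [min_eq_right h', max_eq_right h]
    · rw [min_eq_left h', max_eq_right zero_le_one]
      constructor <;> linarith

theorem IsRestrictedClosed.conn_uniformClosure {X : Type*} {F : Set (X → I)}
    (hF : IsRestrictedClosed F) {k : ℕ} (c : C(Fin k → I, I)) {u : Fin k → X → I}
    (hu : ∀ i, u i ∈ uniformClosure F) :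
    (fun x => c fun i => u i x) ∈ uniformClosure F :=
  hF.uniform.conn (uniformClosure_idem F) c hu

/-! ### Approximation by restricted formulas -/

/-- The functions of a structure and a tuple that are the values of restricted quantifier-free
formulas. -/
def qfValues (L : Signature.{u}) (n : ℕ) : Set ((Σ M : Str L, (Fin n → M)) → I) :=
  {g | ∃ φ : Formula L n, φ.IsRestrictedQF ∧ ∀ x, φ.val x.1 x.2 = g x}

theorem isRestrictedClosed_qfValues (n : ℕ) : IsRestrictedClosed (qfValues L n) where
  zero := ⟨.conn (constConn 0) Fin.elim0, .zero _, fun _ => rfl⟩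
  one := ⟨.conn (constConn 1) Fin.elim0, .one _, fun _ => rfl⟩
  half := by
    rintro f ⟨φ, hφ, h⟩
    refine ⟨.conn halfConn fun _ => φ, .half _ fun _ => hφ, fun x => ?_⟩
    simp only [Formula.val, halfConn_apply, h]
  monus := by
    rintro f ⟨φ, hφ, h⟩ g ⟨ψ, hψ, h'⟩
    refine ⟨.conn monusConn ![φ, ψ], .monus _ fun i => ?_, fun x => ?_⟩
    · fin_cases i
      exacts [hφ, hψ]
    · simp [Formula.val, monusConn_apply, h, h']

theorem Formula.IsQF.exists_restricted {n : ℕ} {φ : Formula L n} (h : φ.IsQF) {ε : ℝ}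
    (hε : 0 < ε) : ∃ ψ : Formula L n, ψ.IsRestrictedQF ∧
      ∀ (M : Str L) (a : Fin n → M), Dist.dist (φ.val M a) (ψ.val M a) ≤ ε := by
  have key : (fun x : Σ M : Str L, (Fin n → M) => φ.val x.1 x.2) ∈
      uniformClosure (qfValues L n) := by
    induction h with
    | dist s t => exact subset_uniformClosure _ ⟨.dist s t, .dist s t, fun _ => rfl⟩
    | pred R ts => exact subset_uniformClosure _ ⟨.pred R ts, .pred R ts, fun _ => rfl⟩
    | conn c φ h ih => exact (isRestrictedClosed_qfValues n).conn_uniformClosure c ih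
  obtain ⟨f, ⟨ψ, hψ, hf⟩, hd⟩ := key ε hε
  refine ⟨ψ, hψ, fun M a => ?_⟩
  have := hd ⟨M, a⟩
  rwa [← hf] at this

/-- A prenex formula as a formula. -/
def Prenex.toFormula : ∀ {n : ℕ}, Prenex L n → Formula L n
  | _, .qf φ _ => φ
  | _, .inf p => .inf p.toFormula
  | _, .sup p => .sup p.toFormula

/-- The value of a prenex formula. -/
noncomputable def Prenex.val (M : Str L) {n : ℕ} (p : Prenex L n) (a : Fin n → M) : I :=
  p.toFormula.val M a

theorem Prenex.val_inf {M : Str L} {n : ℕ} (p : Prenex L (n + 1)) (a : Fin n → M) :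
    p.inf.val M a = ⨅ b : M, p.val M (Fin.snoc a b) := rfl

theorem Prenex.val_sup {M : Str L} {n : ℕ} (p : Prenex L (n + 1)) (a : Fin n → M) :
    p.sup.val M a = ⨆ b : M, p.val M (Fin.snoc a b) := rfl

theorem Term.exists_rename {n : ℕ} (t : Term L n) {m : ℕ} (ρ : Fin n → Fin m) :
    ∃ s : Term L m, ∀ (M : Str L) (a : Fin m → M), s.val M a = t.val M (a ∘ ρ) := by
  induction t with
  | var i => exact ⟨.var (ρ i), fun _ _ => rfl⟩
  | app f ts ih =>
    choose s hs using ih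
    exact ⟨.app f s, fun M a => by simp only [Term.val, hs]⟩

theorem Formula.IsRestrictedQF.exists_rename {n : ℕ} {φ : Formula L n} (h : φ.IsRestrictedQF)
    {m : ℕ} (ρ : Fin n → Fin m) : ∃ ψ : Formula L m, ψ.IsRestrictedQF ∧
      ∀ (M : Str L) (a : Fin m → M), ψ.val M a = φ.val M (a ∘ ρ) := by
  induction h with
  | dist s t =>
    obtain ⟨s', hs⟩ := s.exists_rename ρ
    obtain ⟨t', ht⟩ := t.exists_rename ρ
    exact ⟨.dist s' t', .dist s' t', fun M a => by simp only [Formula.val, hs, ht]⟩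
  | pred R ts =>
    choose s hs using fun i => (ts i).exists_rename ρ
    exact ⟨.pred R s, .pred R s, fun M a => by simp only [Formula.val, hs]⟩
  | zero φ => exact ⟨.conn (constConn 0) Fin.elim0, .zero _, fun M a => rfl⟩
  | one φ => exact ⟨.conn (constConn 1) Fin.elim0, .one _, fun M a => rfl⟩
  | half φ h ih =>
    choose ψ hψ e using ih
    exact ⟨.conn halfConn ψ, .half ψ hψ, fun M a => by simp only [Formula.val, e]⟩
  | monus φ h ih =>
    choose ψ hψ e using ih
    exact ⟨.conn monusConn ψ, .monus ψ hψ, fun M a => by simp only [Formula.val, e]⟩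

theorem snoc_comp_snoc {X : Type*} {n m : ℕ} (ρ : Fin n → Fin m) (a : Fin m → X) (b : X) :
    (Fin.snoc a b : Fin (m + 1) → X) ∘
      (Fin.snoc (Fin.castSucc ∘ ρ) (Fin.last m) : Fin (n + 1) → Fin (m + 1)) =
      Fin.snoc (a ∘ ρ) b := by
  funext i
  induction i using Fin.lastCases <;> simp

theorem Prenex.exists_rename {n : ℕ} (p : Prenex L n) {m : ℕ} (ρ : Fin n → Fin m) :
    ∃ q : Prenex L m, ∀ (M : Str L) (a : Fin m → M), q.val M a = p.val M (a ∘ ρ) := by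
  induction p generalizing m with
  | qf φ h =>
    obtain ⟨ψ, hψ, e⟩ := h.exists_rename ρ
    exact ⟨.qf ψ hψ, e⟩
  | inf p ih =>
    obtain ⟨q, hq⟩ := ih (Fin.snoc (Fin.castSucc ∘ ρ) (Fin.last m))
    exact ⟨.inf q, fun M a => by simp only [Prenex.val_inf, hq, snoc_comp_snoc]⟩
  | sup p ih =>
    obtain ⟨q, hq⟩ := ih (Fin.snoc (Fin.castSucc ∘ ρ) (Fin.last m))
    exact ⟨.sup q, fun M a => by simp only [Prenex.val_sup, hq, snoc_comp_snoc]⟩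

theorem Prenex.exists_lift {n : ℕ} (p : Prenex L n) :
    ∃ q : Prenex L (n + 1), ∀ (M : Str L) (a : Fin n → M) (b : M),
      q.val M (Fin.snoc a b) = p.val M a := by
  obtain ⟨q, hq⟩ := p.exists_rename Fin.castSucc
  refine ⟨q, fun M a b => ?_⟩
  rw [hq]
  congr 1
  funext i
  simp

theorem monotone_halfI : Monotone halfI := fun x y h => by
  rw [← Subtype.coe_le_coe, coe_halfI, coe_halfI]
  exact div_le_div_of_nonneg_right h zero_le_two

theorem monotone_monusI_left (y : I) : Monotone fun x => monusI x y := fun x x' h => by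
  rw [← Subtype.coe_le_coe, coe_monusI, coe_monusI]
  exact max_le_max_right _ (sub_le_sub_right (show (x : ℝ) ≤ x' from h) _)

theorem antitone_monusI_right (x : I) : Antitone fun y => monusI x y := fun y y' h => by
  rw [← Subtype.coe_le_coe, coe_monusI, coe_monusI]
  exact max_le_max_right _ (sub_le_sub_left (show (y : ℝ) ≤ y' from h) _)

theorem continuous_monusI_left (y : I) : Continuous fun x => monusI x y :=
  continuous_monusI.comp (by fun_prop : Continuous fun x : I => (x, y))

theorem continuous_monusI_right (x : I) : Continuous fun y => monusI x y :=
  continuous_monusI.comp (by fun_prop : Continuous fun y : I => (x, y))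

theorem Prenex.exists_half {n : ℕ} (p : Prenex L n) :
    ∃ q : Prenex L n, ∀ (M : Str L) (a : Fin n → M), q.val M a = halfI (p.val M a) := by
  induction p with
  | qf φ h => exact ⟨.qf (.conn halfConn fun _ => φ) (.half _ fun _ => h), fun _ _ => rfl⟩
  | inf p ih =>
    obtain ⟨q, hq⟩ := ih
    refine ⟨.inf q, fun M a => ?_⟩
    simp only [Prenex.val_inf, hq]
    exact (monotone_halfI.map_ciInf_of_continuousAt continuous_halfI.continuousAt
      (OrderBot.bddBelow _)).symm
  | sup p ih =>
    obtain ⟨q, hq⟩ := ih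
    refine ⟨.sup q, fun M a => ?_⟩
    simp only [Prenex.val_sup, hq]
    exact (monotone_halfI.map_ciSup_of_continuousAt continuous_halfI.continuousAt
      (OrderTop.bddAbove _)).symm

/-- Truncated subtraction is continuous and antitone in its second argument, so the quantifiers of
`q` move out with `inf` and `sup` exchanged. -/
theorem Prenex.exists_monus_qf {n : ℕ} (q : Prenex L n) {φ : Formula L n}
    (h : φ.IsRestrictedQF) : ∃ r : Prenex L n, ∀ (M : Str L) (a : Fin n → M),
      r.val M a = monusI (φ.val M a) (q.val M a) := by
  induction q with
  | qf ψ hψ =>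
    obtain ⟨χ, hχ, e⟩ := (isRestrictedClosed_qfValues (L := L) _).monus _
      ⟨φ, h, fun _ => rfl⟩ _ ⟨ψ, hψ, fun _ => rfl⟩
    exact ⟨.qf χ hχ, fun M a => e ⟨M, a⟩⟩
  | @inf n q ih =>
    obtain ⟨φ', h', e⟩ := h.exists_rename (Fin.castSucc : Fin n → Fin (n + 1))
    obtain ⟨r, hr⟩ := ih h'
    refine ⟨.sup r, fun M a => ?_⟩
    have : ∀ b : M, (Fin.snoc a b : Fin (n + 1) → M) ∘ Fin.castSucc = a := fun b => by
      funext i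
      simp
    simp only [Prenex.val_sup, Prenex.val_inf, hr, e, this]
    exact ((antitone_monusI_right _).map_ciInf_of_continuousAt
      (continuous_monusI_right _).continuousAt (OrderBot.bddBelow _)).symm
  | @sup n q ih =>
    obtain ⟨φ', h', e⟩ := h.exists_rename (Fin.castSucc : Fin n → Fin (n + 1))
    obtain ⟨r, hr⟩ := ih h'
    refine ⟨.inf r, fun M a => ?_⟩
    have : ∀ b : M, (Fin.snoc a b : Fin (n + 1) → M) ∘ Fin.castSucc = a := fun b => by
      funext i
      simp
    simp only [Prenex.val_sup, Prenex.val_inf, hr, e, this]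
    exact ((antitone_monusI_right _).map_ciSup_of_continuousAt
      (continuous_monusI_right _).continuousAt (OrderTop.bddAbove _)).symm

/-- The quantifiers of `p` move out unchanged, by monotonicity in the first argument; `q` acquires a
dummy variable each time. -/
theorem Prenex.exists_monus {n : ℕ} (p q : Prenex L n) : ∃ r : Prenex L n,
    ∀ (M : Str L) (a : Fin n → M), r.val M a = monusI (p.val M a) (q.val M a) := by
  induction p with
  | qf φ h => exact q.exists_monus_qf h
  | inf p ih =>
    obtain ⟨q', hq⟩ := q.exists_lift
    obtain ⟨r, hr⟩ := ih q'
    refine ⟨.inf r, fun M a => ?_⟩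
    simp only [Prenex.val_inf, hr, hq]
    exact ((monotone_monusI_left _).map_ciInf_of_continuousAt
      (continuous_monusI_left _).continuousAt (OrderBot.bddBelow _)).symm
  | sup p ih =>
    obtain ⟨q', hq⟩ := q.exists_lift
    obtain ⟨r, hr⟩ := ih q'
    refine ⟨.sup r, fun M a => ?_⟩
    simp only [Prenex.val_sup, hr, hq]
    exact ((monotone_monusI_left _).map_ciSup_of_continuousAt
      (continuous_monusI_left _).continuousAt (OrderTop.bddAbove _)).symm

/-- The functions of a structure and a tuple that are the values of restricted prenex
formulas. -/
def prenexValues (L : Signature.{u}) (n : ℕ) : Set ((Σ M : Str L, (Fin n → M)) → I) :=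
  {g | ∃ p : Prenex L n, ∀ x, p.val x.1 x.2 = g x}

theorem isRestrictedClosed_prenexValues (n : ℕ) : IsRestrictedClosed (prenexValues L n) where
  zero := ⟨.qf (.conn (constConn 0) Fin.elim0) (.zero _), fun _ => rfl⟩
  one := ⟨.qf (.conn (constConn 1) Fin.elim0) (.one _), fun _ => rfl⟩
  half := by
    rintro f ⟨p, h⟩
    obtain ⟨q, hq⟩ := p.exists_half
    exact ⟨q, fun x => by rw [hq, h]⟩
  monus := by
    rintro f ⟨p, h⟩ g ⟨q, h'⟩
    obtain ⟨r, hr⟩ := p.exists_monus q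
    exact ⟨r, fun x => by rw [hr, h, h']⟩

theorem dist_iInf_le {ι : Type*} [Nonempty ι] {f g : ι → I} {ε : ℝ}
    (h : ∀ i, dist (f i) (g i) ≤ ε) : dist (⨅ i, f i) (⨅ i, g i) ≤ ε := by
  have key : ∀ f g : ι → I, (∀ i, dist (f i) (g i) ≤ ε) →
      ((⨅ i, f i : I) : ℝ) ≤ ((⨅ i, g i : I) : ℝ) + ε := fun f g h => by
    rw [← sub_le_iff_le_add]
    refine le_of_forall_gt fun c hc => ?_
    by_cases hc1 : 1 < c
    · have h1 := (⨅ i, f i).2.2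
      have := dist_nonneg.trans (h (Classical.arbitrary ι))
      linarith
    have hlt : (⨅ i, g i) < (⟨c, (⨅ i, g i).2.1.trans hc.le, not_lt.1 hc1⟩ : I) := hc
    obtain ⟨i, hi⟩ := iInf_lt_iff.1 hlt
    have h1 := h i
    have h2 : ((⨅ i, f i : I) : ℝ) ≤ f i := iInf_le f i
    have h3 : (g i : ℝ) < c := hi
    rw [Subtype.dist_eq, Real.dist_eq, abs_le] at h1
    linarith
  rw [Subtype.dist_eq, Real.dist_eq, abs_le]
  have h1 := key f g h
  have h2 := key g f fun i => by rw [dist_comm]; exact h i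
  constructor <;> linarith

theorem dist_iSup_le {ι : Type*} [Nonempty ι] {f g : ι → I} {ε : ℝ}
    (h : ∀ i, dist (f i) (g i) ≤ ε) : dist (⨆ i, f i) (⨆ i, g i) ≤ ε := by
  have key : ∀ f g : ι → I, (∀ i, dist (f i) (g i) ≤ ε) →
      ((⨆ i, f i : I) : ℝ) ≤ ((⨆ i, g i : I) : ℝ) + ε := fun f g h => by
    refine le_of_forall_lt fun c hc => ?_
    by_cases hc0 : c < 0
    · have h1 := (⨆ i, g i).2.1
      have := dist_nonneg.trans (h (Classical.arbitrary ι))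
      linarith
    have hlt : (⟨c, not_lt.1 hc0, hc.le.trans (⨆ i, f i).2.2⟩ : I) < ⨆ i, f i := hc
    obtain ⟨i, hi⟩ := lt_iSup_iff.1 hlt
    have h1 := h i
    have h2 : (g i : ℝ) ≤ ((⨆ i, g i : I) : ℝ) := le_iSup g i
    have h3 : c < (f i : ℝ) := hi
    rw [Subtype.dist_eq, Real.dist_eq, abs_le] at h1
    linarith
  rw [Subtype.dist_eq, Real.dist_eq, abs_le]
  have h1 := key f g h
  have h2 := key g f fun i => by rw [dist_comm]; exact h i
  constructor <;> linarith

/-- Every formula is a uniform limit of restricted prenex formulas. -/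
theorem Formula.exists_prenex {n : ℕ} (φ : Formula L n) {ε : ℝ} (hε : 0 < ε) :
    ∃ p : Prenex L n, ∀ (M : Str L) (a : Fin n → M),
      Dist.dist (φ.val M a) (p.val M a) ≤ ε := by
  suffices key : (fun x : Σ M : Str L, (Fin n → M) => φ.val x.1 x.2) ∈
      uniformClosure (prenexValues L n) by
    obtain ⟨f, ⟨p, hf⟩, hd⟩ := key ε hε
    refine ⟨p, fun M a => ?_⟩
    have := hd ⟨M, a⟩
    rwa [← hf] at this
  clear hε
  induction φ with
  | dist s t => exact subset_uniformClosure _ ⟨.qf (.dist s t) (.dist s t), fun _ => rfl⟩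
  | pred R ts => exact subset_uniformClosure _ ⟨.qf (.pred R ts) (.pred R ts), fun _ => rfl⟩
  | conn c φ ih => exact (isRestrictedClosed_prenexValues _).conn_uniformClosure c ih
  | inf φ ih =>
    intro ε hε
    obtain ⟨f, ⟨p, hp⟩, hd⟩ := ih ε hε
    refine ⟨_, ⟨.inf p, fun _ => rfl⟩, fun x => dist_iInf_le fun b => ?_⟩
    have := hd ⟨x.1, Fin.snoc x.2 b⟩
    rwa [← hp] at this
  | sup φ ih =>
    intro ε hε
    obtain ⟨f, ⟨p, hp⟩, hd⟩ := ih ε hε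
    refine ⟨_, ⟨.sup p, fun _ => rfl⟩, fun x => dist_iSup_le fun b => ?_⟩
    have := hd ⟨x.1, Fin.snoc x.2 b⟩
    rwa [← hp] at this

/-! ### Completions and unions of chains -/

/-- Extension of a map from a dense subspace, with the same modulus of uniform continuity. -/
theorem exists_extension {A B E : Type*} [PseudoMetricSpace A] [PseudoMetricSpace B]
    [MetricSpace E] [CompleteSpace E] {e : A → B} (he : Isometry e) (hd : DenseRange e)
    (f : A → E) (m : ℝ → ℝ) (hm : ∀ ε, 0 < ε → 0 < m ε)
    (hf : ∀ ε, 0 < ε → ∀ x y, dist x y < m ε → dist (f x) (f y) ≤ ε) :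
    ∃ g : B → E, (∀ x, g (e x) = f x) ∧
      ∀ ε, 0 < ε → ∀ x y, dist x y < m ε → dist (g x) (g y) ≤ ε := by
  have hu : UniformContinuous f := Metric.uniformContinuous_iff.2 fun ε hε =>
    ⟨m (ε / 2), hm _ (half_pos hε), fun {x y} h =>
      (hf _ (half_pos hε) x y h).trans_lt (half_lt_self hε)⟩
  have hi := he.isUniformInducing
  have hc := (uniformContinuous_uniformly_extend hi hd hu).continuous
  have hg := fun x => (hi.isDenseInducing hd).extend_eq hu.continuous x
  generalize (hi.isDenseInducing hd).extend f = g at hc hg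
  refine ⟨g, hg, fun ε hε x y hxy => ?_⟩
  by_contra! hlt
  -- Violations of the modulus form an open set, which would meet the dense image of `A × A`. The
  -- form of the modulus, strict hypothesis and weak conclusion, is what makes this work.
  have ho : IsOpen {p : B × B | dist p.1 p.2 < m ε ∧ ε < dist (g p.1) (g p.2)} :=
    (isOpen_lt continuous_dist continuous_const).inter
      (isOpen_lt continuous_const
        ((hc.comp continuous_fst).dist (hc.comp continuous_snd)))
  obtain ⟨⟨a, b⟩, h1, h2⟩ := (hd.prodMap hd).exists_mem_open ho ⟨(x, y), hxy, hlt⟩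
  simp only [Prod.map_apply, hg, he.dist_eq] at h1 h2
  exact h2.not_ge (hf ε hε a b h1)

theorem isometry_comp_left {A B : Type*} [PseudoMetricSpace A] [PseudoMetricSpace B]
    {e : A → B} (he : Isometry e) (k : ℕ) : Isometry fun x : Fin k → A => e ∘ x :=
  Isometry.of_dist_eq fun x y => by simp [dist_pi_def, he.nndist_eq]

/-- The completion of an incomplete metric structure. -/
theorem exists_completion {P : Type u} [PseudoMetricSpace P] [Nonempty P]
    (h1 : ∀ x y : P, dist x y ≤ 1)
    (func : ∀ {k : ℕ}, L.Func k → (Fin k → P) → P)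
    (pred : ∀ {k : ℕ}, L.Pred k → (Fin k → P) → I)
    (hf : ∀ {k : ℕ} (f : L.Func k) (ε : ℝ), 0 < ε → ∀ x y : Fin k → P,
      dist x y < L.funcMod f ε → dist (func f x) (func f y) ≤ ε)
    (hR : ∀ {k : ℕ} (R : L.Pred k) (ε : ℝ), 0 < ε → ∀ x y : Fin k → P,
      dist x y < L.predMod R ε → dist (pred R x) (pred R y) ≤ ε) :
    ∃ (M : Str L) (e : P → M), Isometry e ∧ DenseRange e ∧
      (∀ {k : ℕ} (f : L.Func k) (x : Fin k → P), M.func f (e ∘ x) = e (func f x)) ∧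
      ∀ {k : ℕ} (R : L.Pred k) (x : Fin k → P), M.pred R (e ∘ x) = pred R x := by
  -- This completion is Hausdorff, so points of `P` at distance `0` are identified as well.
  let Q := UniformSpace.Completion P
  let e : P → Q := fun x => x
  have he : Isometry e := UniformSpace.Completion.coe_isometry
  have hd : DenseRange e := UniformSpace.Completion.denseRange_coe
  have hk : ∀ k : ℕ, DenseRange fun x : Fin k → P => e ∘ x := fun k =>
    DenseRange.piMap fun _ => hd
  have hF : ∀ {k : ℕ} (f : L.Func k), ∃ g : (Fin k → Q) → Q,
      (∀ x, g (e ∘ x) = e (func f x)) ∧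
      ∀ ε, 0 < ε → ∀ x y, dist x y < L.funcMod f ε → dist (g x) (g y) ≤ ε := fun {k} f =>
    exists_extension (isometry_comp_left he k) (hk k) (fun x => e (func f x)) (L.funcMod f)
      (L.funcMod_pos f) fun ε hε x y h => by
        rw [he.dist_eq]
        exact hf f ε hε x y h
  have hP : ∀ {k : ℕ} (R : L.Pred k), ∃ g : (Fin k → Q) → I,
      (∀ x, g (e ∘ x) = pred R x) ∧
      ∀ ε, 0 < ε → ∀ x y, dist x y < L.predMod R ε → dist (g x) (g y) ≤ ε := fun {k} R =>
    exists_extension (isometry_comp_left he k) (hk k) (pred R) (L.predMod R)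
      (L.predMod_pos R) (hR R)
  choose F hF1 hF2 using @hF
  choose G hG1 hG2 using @hP
  have : Nonempty Q := ⟨e (Classical.arbitrary P)⟩
  refine ⟨⟨Q, ?_, @F, @G, @hF2, @hG2⟩, e, he, hd, @hF1, @hG1⟩
  intro x y
  refine UniformSpace.Completion.induction_on₂ x y (isClosed_le (by fun_prop) (by fun_prop)) ?_
  intro a b
  rw [UniformSpace.Completion.dist_eq]
  exact h1 a b

section Chain

variable {ι : Type u} [LinearOrder ι] {S : ι → Str L}

/-- A chain of structures with coherent transition embeddings. -/
structure ChainMaps (S : ι → Str L) where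
  t : ∀ {i j : ι}, i ≤ j → Emb (S i) (S j)
  t_trans : ∀ {i j k : ι} (h : i ≤ j) (h' : j ≤ k) (x : S i), t h' (t h x) = t (h.trans h') x

/-- The disjoint union of the members of a chain. -/
structure ChainMaps.Union (c : ChainMaps S) : Type u where
  idx : ι
  elt : S idx

namespace ChainMaps

variable (c : ChainMaps S)

/-- The image of an element of the disjoint union at a later stage. -/
def push (k : ι) (x : c.Union) (h : x.idx ≤ k) : S k := c.t h x.elt

theorem t_push {j k : ι} (x : c.Union) (h : x.idx ≤ j) (h' : j ≤ k) :
    c.t h' (c.push j x h) = c.push k x (h.trans h') := c.t_trans _ _ _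

theorem dist_push {j k : ι} (x y : c.Union) (hx : x.idx ≤ j) (hy : y.idx ≤ j) (hx' : x.idx ≤ k)
    (hy' : y.idx ≤ k) : dist (c.push j x hx) (c.push j y hy) =
      dist (c.push k x hx') (c.push k y hy') := by
  rcases le_total j k with h | h
  · rw [← (c.t h).isometry.dist_eq, c.t_push, c.t_push]
  · rw [← (c.t h).isometry.dist_eq (c.push k x hx'), c.t_push, c.t_push]

/-- Distances are measured at a common stage. An element and its later images are at distance `0`,
so no quotient is taken before completing. -/
instance : PseudoMetricSpace c.Union where
  dist x y := dist (c.push (x.idx ⊔ y.idx) x le_sup_left) (c.push (x.idx ⊔ y.idx) y le_sup_right)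
  dist_self x := dist_self _
  dist_comm x y := by
    rw [dist_comm]
    exact c.dist_push _ _ _ _ _ _
  dist_triangle x y z := by
    have h1 : x.idx ≤ x.idx ⊔ y.idx ⊔ z.idx := le_sup_left.trans le_sup_left
    have h2 : y.idx ≤ x.idx ⊔ y.idx ⊔ z.idx := le_sup_right.trans le_sup_left
    have h3 : z.idx ≤ x.idx ⊔ y.idx ⊔ z.idx := le_sup_right
    rw [c.dist_push x z _ _ h1 h3, c.dist_push x y _ _ h1 h2, c.dist_push y z _ _ h2 h3]
    exact dist_triangle _ _ _

theorem dist_eq (k : ι) (x y : c.Union) (hx : x.idx ≤ k) (hy : y.idx ≤ k) :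
    dist x y = dist (c.push k x hx) (c.push k y hy) :=
  c.dist_push _ _ _ _ _ _

theorem dist_tuple_eq (k : ι) {n : ℕ} (x y : Fin n → c.Union) (hx : ∀ i, (x i).idx ≤ k)
    (hy : ∀ i, (y i).idx ≤ k) : dist x y =
      dist (fun i => c.push k (x i) (hx i)) (fun i => c.push k (y i) (hy i)) := by
  refine le_antisymm ((dist_pi_le_iff dist_nonneg).2 fun i => ?_)
    ((dist_pi_le_iff dist_nonneg).2 fun i => ?_)
  · rw [c.dist_eq k _ _ (hx i) (hy i)]
    exact dist_le_pi_dist (fun i => c.push k (x i) (hx i)) (fun i => c.push k (y i) (hy i)) i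
  · rw [← c.dist_eq]
    exact dist_le_pi_dist x y i

variable [Nonempty ι]

instance : Nonempty c.Union :=
  ⟨⟨Classical.arbitrary ι, Classical.arbitrary (S (Classical.arbitrary ι))⟩⟩

/-- A stage at which all entries of a tuple are present. -/
noncomputable def stage {n : ℕ} (x : Fin n → c.Union) : ι :=
  (Finite.exists_le fun i => (x i).idx).choose

theorem le_stage {n : ℕ} (x : Fin n → c.Union) (i : Fin n) : (x i).idx ≤ c.stage x :=
  (Finite.exists_le fun i => (x i).idx).choose_spec i

/-- The interpretation of a function symbol in the union. -/
noncomputable def func {n : ℕ} (f : L.Func n) (x : Fin n → c.Union) : c.Union :=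
  ⟨c.stage x, (S _).func f fun i => c.push _ (x i) (c.le_stage x i)⟩

theorem idx_func_le {n : ℕ} (f : L.Func n) (x : Fin n → c.Union) {k : ι}
    (h : c.stage x ≤ k) : (c.func f x).idx ≤ k := h

theorem push_func {n : ℕ} (f : L.Func n) (x : Fin n → c.Union) {k : ι} (h : c.stage x ≤ k) :
    c.push k (c.func f x) (c.idx_func_le f x h) =
      (S k).func f fun i => c.push k (x i) ((c.le_stage x i).trans h) := by
  refine ((c.t h).map_func f _).trans ?_
  congr 1
  funext i
  exact c.t_push _ _ _

/-- The interpretation of a predicate symbol in the union. -/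
noncomputable def pred {n : ℕ} (R : L.Pred n) (x : Fin n → c.Union) : I :=
  (S _).pred R fun i => c.push _ (x i) (c.le_stage x i)

theorem pred_eq {n : ℕ} (R : L.Pred n) (x : Fin n → c.Union) {k : ι} (h : c.stage x ≤ k) :
    c.pred R x = (S k).pred R fun i => c.push k (x i) ((c.le_stage x i).trans h) := by
  refine ((c.t h).map_pred R _).symm.trans ?_
  congr 1
  funext i
  exact c.t_push _ _ _

/-- The completed union of a chain. -/
theorem exists_union : ∃ (M : Str L) (g : ∀ i, Emb (S i) M),
    (∀ {i j : ι} (h : i ≤ j) (x : S i), g j (c.t h x) = g i x) ∧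
      Dense (⋃ i, Set.range (g i)) := by
  obtain ⟨M, e, he, hd, hf, hR⟩ := exists_completion (L := L) (P := c.Union)
    (fun x y => (S _).dist_le_one _ _) (fun f x => c.func f x) (fun R x => c.pred R x)
    (fun {n} f ε hε x y h => by
      have hx := fun i => (c.le_stage x i).trans (le_max_left _ (c.stage y))
      have hy := fun i => (c.le_stage y i).trans (le_max_right (c.stage x) _)
      rw [c.dist_tuple_eq _ x y hx hy] at h
      rw [c.dist_eq (c.stage x ⊔ c.stage y) (c.func f x) (c.func f y)
        (c.idx_func_le f x le_sup_left) (c.idx_func_le f y le_sup_right),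
        c.push_func f x le_sup_left, c.push_func f y le_sup_right]
      exact (S _).func_unif f ε hε _ _ h)
    (fun {n} R ε hε x y h => by
      have hx := fun i => (c.le_stage x i).trans (le_max_left _ (c.stage y))
      have hy := fun i => (c.le_stage y i).trans (le_max_right (c.stage x) _)
      rw [c.dist_tuple_eq _ x y hx hy] at h
      rw [c.pred_eq R x (le_max_left _ (c.stage y)), c.pred_eq R y (le_max_right _ _)]
      exact (S _).pred_unif R ε hε _ _ h)
  have heq : ∀ {k : ι} (x y : c.Union) (hx : x.idx ≤ k) (hy : y.idx ≤ k),
      c.push k x hx = c.push k y hy → e x = e y := fun {k} x y hx hy h => by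
    rw [← dist_eq_zero, he.dist_eq, c.dist_eq k x y hx hy, h, dist_self]
  refine ⟨M, fun i => ⟨fun x => e ⟨i, x⟩, ?_, ?_, ?_⟩, ?_, ?_⟩
  · refine Isometry.of_dist_eq fun x y => ?_
    rw [he.dist_eq, c.dist_eq i _ _ le_rfl le_rfl]
    exact (c.t le_rfl).isometry.dist_eq _ _
  · intro k f x
    have h := hf f fun j => (⟨i, x j⟩ : c.Union)
    refine Eq.trans ?_ h.symm
    refine heq (k := i ⊔ c.stage fun j => (⟨i, x j⟩ : c.Union)) _ _ le_sup_left
      (c.idx_func_le f _ le_sup_right) ?_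
    rw [c.push_func f _ le_sup_right]
    exact (c.t le_sup_left).map_func f x
  · intro k R x
    have h := hR R fun j => (⟨i, x j⟩ : c.Union)
    refine h.trans ?_
    rw [c.pred_eq (k := i ⊔ c.stage fun j => (⟨i, x j⟩ : c.Union)) R _ le_sup_right]
    exact (c.t le_sup_left).map_pred R x
  · intro i j h x
    -- Coherence with `le_rfl` replaces an axiom that `t le_rfl` is the identity.
    exact heq (k := j) _ _ le_rfl h (c.t_trans h le_rfl x)
  · refine hd.mono ?_
    rintro _ ⟨⟨i, x⟩, rfl⟩
    exact Set.mem_iUnion.2 ⟨i, x, rfl⟩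

end ChainMaps

end Chain

/-! ### Labelled structures -/

/-- A structure whose elements are labelled injectively by ordinals. Embeddings that preserve
labels are unique, so that they form coherent systems. -/
structure LabStr (L : Signature.{u}) where
  str : Str L
  lab : str → Ordinal.{u}
  inj : Function.Injective lab

/-- Embeddings that preserve labels. -/
def LabStr.IsEmb {A B : LabStr L} (f : Emb A.str B.str) : Prop := ∀ x, B.lab (f x) = A.lab x

instance : Preorder (LabStr L) where
  le A B := ∃ f : Emb A.str B.str, LabStr.IsEmb f
  le_refl A := ⟨Emb.refl _, fun _ => rfl⟩
  le_trans A B C := by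
    rintro ⟨f, hf⟩ ⟨g, hg⟩
    exact ⟨g.comp f, fun x => (hg _).trans (hf x)⟩

theorem LabStr.IsEmb.comp {A B C : LabStr L} {f : Emb A.str B.str} {g : Emb B.str C.str}
    (hg : LabStr.IsEmb g) (hf : LabStr.IsEmb f) : LabStr.IsEmb (g.comp f) :=
  fun x => (hg _).trans (hf x)

theorem LabStr.IsEmb.coe_eq {A B : LabStr L} {f g : Emb A.str B.str} (hf : LabStr.IsEmb f)
    (hg : LabStr.IsEmb g) : (f : A.str → B.str) = g :=
  funext fun x => B.inj ((hf x).trans (hg x).symm)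

theorem exists_injective_ordinal (Y : Type u) :
    ∃ f : Y → Ordinal.{u}, Function.Injective f :=
  ⟨_, Ordinal.typein_injective (WellOrderingRel (α := Y))⟩

/-- Labels of a part of a type extend to the whole type. -/
theorem exists_labelling {P Y : Type u} (s : P → Ordinal.{u}) (g : P → Y)
    (h : ∀ x y, s x = s y ↔ g x = g y) :
    ∃ lab : Y → Ordinal.{u}, Function.Injective lab ∧ ∀ x, lab (g x) = s x := by
  classical
  obtain ⟨r, hr⟩ := exists_injective_ordinal Y
  -- New elements receive labels from `α` onwards, above all labels already in use.
  set α := Order.succ (⨆ p, s p)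
  have hs : ∀ p o, s p ≠ α + o := fun p o =>
    (((Order.lt_succ_of_le (Ordinal.le_iSup s p)).trans_le le_self_add)).ne
  refine ⟨fun y => if hy : ∃ p, g p = y then s hy.choose else α + r y, fun y z hyz => ?_,
    fun x => ?_⟩
  · simp only at hyz
    split_ifs at hyz with h1 h2 h2
    · rw [← h1.choose_spec, ← h2.choose_spec]
      exact (h _ _).1 hyz
    · exact (hs _ _ hyz).elim
    · exact (hs _ _ hyz.symm).elim
    · exact hr (add_left_cancel hyz)
  · have hx : ∃ p, g p = g x := ⟨x, rfl⟩
    simp only [dif_pos hx]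
    exact (h _ _).2 hx.choose_spec

theorem LabStr.exists_of_emb (A : LabStr L) {N : Str L} (f : Emb A.str N) :
    ∃ lab : N → Ordinal.{u}, Function.Injective lab ∧ ∀ x, lab (f x) = A.lab x :=
  exists_labelling A.lab f fun _ _ => A.inj.eq_iff.trans f.isometry.injective.eq_iff.symm

/-- The union of a chain of labelled structures. -/
theorem LabStr.exists_union {K : Set (Str L)} (hK : Inductive K) {ι : Type u} [LinearOrder ι]
    [Nonempty ι] {A : ι → LabStr L} (hA : Monotone A) (h : ∀ i, (A i).str ∈ K) :
    ∃ B : LabStr L, B.str ∈ K ∧ ∃ g : ∀ i, Emb (A i).str B.str,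
      (∀ i, LabStr.IsEmb (g i)) ∧
      (∀ i j, i ≤ j → Set.range (g i) ⊆ Set.range (g j)) ∧ Dense (⋃ i, Set.range (g i)) := by
  choose t ht using @hA
  let c : ChainMaps fun i => (A i).str :=
    ⟨fun {i j} h => t h, fun h h' x => congrFun (((ht h').comp (ht h)).coe_eq (ht (h.trans h'))) x⟩
  obtain ⟨M, g, hg, hd⟩ := c.exists_union
  have hr : ∀ i j, i ≤ j → Set.range (g i) ⊆ Set.range (g j) := by
    rintro i j hij _ ⟨x, rfl⟩
    exact ⟨_, hg hij x⟩
  -- Elements of different stages share a label exactly when they become equal in the union, so the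
  -- labels descend to it.
  have hlab : ∀ {i j : ι} (hij : i ≤ j) (x : (A i).str) (y : (A j).str),
      (A i).lab x = (A j).lab y ↔ g i x = g j y := fun {i j} hij x y => by
    rw [← ht hij x, (A j).inj.eq_iff, ← hg hij x, (g j).isometry.injective.eq_iff]
  obtain ⟨lab, hl, he⟩ := exists_labelling (P := Σ i, (A i).str) (fun p => (A p.1).lab p.2)
    (fun p => g p.1 p.2) fun x y => by
      rcases le_total x.1 y.1 with hij | hij
      · exact hlab hij _ _
      · rw [eq_comm, hlab hij, eq_comm]
  exact ⟨⟨M, lab, hl⟩, hK ι _ M g h hr hd, g, fun i x => he ⟨i, x⟩, hr, hd⟩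

/-! ### Existence of generic structures -/

/-- The comparisons with parameters from a given structure. -/
def Comparison (M : Str L) : Type u :=
  Σ n : ℕ, Prenex L n × (Fin n → M) × {r : I × I // r.1 < r.2}

/-- The comparison `c` is decided in `N`. -/
def Comparison.Decided (K : Set (Str L)) {M N : Str L} (c : Comparison M) (f : M → N) : Prop :=
  Forces K c.2.1 N (f ∘ c.2.2.1) .lt c.2.2.2.1.2 ∨ Forces K c.2.1 N (f ∘ c.2.2.1) .gt c.2.2.2.1.1

theorem Comparison.Decided.emb {M N P : Str L} {c : Comparison M} {f : M → N}
    (h : c.Decided K f) (g : Emb N P) : c.Decided K (g ∘ f) :=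
  h.imp (Forces.lt_emb g) (Forces.gt_emb g)

/-- The comparisons over `A` that are decided in `B`. -/
def decidedSet (K : Set (Str L)) (A B : LabStr L) : Set (Comparison A.str) :=
  {c | ∃ f : Emb A.str B.str, LabStr.IsEmb f ∧ c.Decided K f}

theorem decidedSet_mono {A B C : LabStr L} (h : B ≤ C) : decidedSet K A B ⊆ decidedSet K A C := by
  rintro c ⟨f, hf, hc⟩
  obtain ⟨g, hg⟩ := h
  exact ⟨g.comp f, hg.comp hf, hc.emb g⟩

/-- The extension relation to which Zorn's lemma is applied: proper extensions have to decide
more comparisons over `A`, so that chains are small. -/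
def ExtRel (K : Set (Str L)) (A : LabStr L) (B C : {B : LabStr L // A ≤ B ∧ B.str ∈ K}) : Prop :=
  B = C ∨ B.1 ≤ C.1 ∧ decidedSet K A B.1 ⊂ decidedSet K A C.1

theorem ExtRel.trans {A : LabStr L} {B C D : {B : LabStr L // A ≤ B ∧ B.str ∈ K}}
    (h : ExtRel K A B C) (h' : ExtRel K A C D) : ExtRel K A B D := by
  rcases h with rfl | ⟨h1, h2⟩
  · exact h'
  rcases h' with rfl | ⟨h3, h4⟩
  · exact .inr ⟨h1, h2⟩
  · exact .inr ⟨h1.trans h3, h2.trans h4⟩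

theorem ExtRel.le {A : LabStr L} {B C : {B : LabStr L // A ≤ B ∧ B.str ∈ K}}
    (h : ExtRel K A B C) : B.1 ≤ C.1 := by
  rcases h with rfl | h
  exacts [le_rfl, h.1]

/-- A chain without a greatest element is reindexed by its sets of decided comparisons. These form a
type in universe `u`, as inductivity requires, although the chain itself lives one universe higher.
-/
theorem exists_upper_bound_of_isChain (hK : Inductive K) {A : LabStr L} (hA : A.str ∈ K)
    (c : Set {B : LabStr L // A ≤ B ∧ B.str ∈ K}) (hc : IsChain (ExtRel K A) c) :
    ∃ m, ∀ B ∈ c, ExtRel K A B m := by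
  classical
  by_cases hmax : ∃ m ∈ c, ∀ B ∈ c, ExtRel K A B m
  · obtain ⟨m, -, hm⟩ := hmax
    exact ⟨m, hm⟩
  push Not at hmax
  rcases c.eq_empty_or_nonempty with rfl | ⟨B₀, hB₀⟩
  · exact ⟨⟨A, le_rfl, hA⟩, by simp⟩
  let D : {B : LabStr L // A ≤ B ∧ B.str ∈ K} → Set (Comparison A.str) :=
    fun B => decidedSet K A B.1
  have htot : ∀ B ∈ c, ∀ C ∈ c, ExtRel K A B C ∨ ExtRel K A C B := fun B hB C hC => by
    by_cases h : B = C
    · exact .inl (.inl h)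
    · exact hc hB hC h
  have hle : ∀ B ∈ c, ∀ C ∈ c, D B ⊆ D C → ExtRel K A B C := fun B hB C hC h => by
    rcases htot B hB C hC with h1 | rfl | h1
    · exact h1
    · exact .inl rfl
    · exact (h1.2.not_subset h).elim
  have hch : IsChain (· ≤ ·) (D '' c) := by
    rintro _ ⟨B, hB, rfl⟩ _ ⟨C, hC, rfl⟩ -
    exact (htot B hB C hC).imp (fun h => decidedSet_mono h.le) fun h => decidedSet_mono h.le
  let _ : LinearOrder (D '' c) := hch.linearOrder
  have : Nonempty (D '' c) := ⟨⟨_, B₀, hB₀, rfl⟩⟩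
  choose S hS hDS using fun d : D '' c => d.2
  have hmono : Monotone fun d => (S d).1 := fun d e h => (hle _ (hS d) _ (hS e) (by
    rw [hDS, hDS]
    exact h)).le
  obtain ⟨U, hU, g, hg, -, -⟩ := LabStr.exists_union hK hmono fun d => (S d).2.2
  have hSU : ∀ d, (S d).1 ≤ U := fun d => ⟨g d, hg d⟩
  have hcU : ∀ B ∈ c, B.1 ≤ U := fun B hB =>
    (hle B hB _ (hS ⟨D B, B, hB, rfl⟩) (hDS ⟨D B, B, hB, rfl⟩).ge).le.trans (hSU _)
  refine ⟨⟨U, B₀.2.1.trans (hcU B₀ hB₀), hU⟩, fun B hB => .inr ⟨hcU B hB, ?_⟩⟩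
  -- Strictness: if the union decided no more than `B`, neither would any `C` in the chain, and `B`
  -- would be greatest.
  obtain ⟨C, hC, hCB⟩ := hmax B hB
  exact ⟨decidedSet_mono (hcU B hB), fun h =>
    hCB (hle C hC B hB ((decidedSet_mono (hcU C hC)).trans h))⟩

/-- Every structure of the class extends to one that decides all comparisons over it. -/
theorem exists_decides (hK : Inductive K) (A : LabStr L) (hA : A.str ∈ K) :
    ∃ B : LabStr L, B.str ∈ K ∧ ∃ f : Emb A.str B.str, LabStr.IsEmb f ∧
      ∀ (n : ℕ) (p : Prenex L n) (a : Fin n → A.str), Decides K p B.str (f ∘ a) := by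
  obtain ⟨m, hm⟩ := exists_maximal_of_chains_bounded
    (exists_upper_bound_of_isChain hK hA) ExtRel.trans
  obtain ⟨f, hf⟩ := m.2.1
  refine ⟨m.1, m.2.2, f, hf, fun n p a r r' hr => ?_⟩
  by_contra hn
  let c : Comparison A.str := ⟨n, p, a, ⟨(r, r'), hr⟩⟩
  have hcm : c ∉ decidedSet K A m.1 := by
    rintro ⟨g, hg, h⟩
    rw [hg.coe_eq hf] at h
    exact hn h
  -- An extension deciding the missing comparison lies strictly above the maximal `m`.
  obtain ⟨N, hN, g, hg⟩ := exists_emb_forces p m.2.2 (f ∘ a) hr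
  obtain ⟨lab, hl, hlab⟩ := m.1.exists_of_emb g
  let B : LabStr L := ⟨N, lab, hl⟩
  have hmB : m.1 ≤ B := ⟨g, hlab⟩
  have hcB : c ∈ decidedSet K A B := ⟨g.comp f, fun x => (hlab _).trans (hf x), hg⟩
  have hsub := decidedSet_mono (K := K) (A := A) hmB
  rcases hm ⟨B, m.2.1.trans hmB, hN⟩ (.inr ⟨hmB, hsub, fun h => hcm (h hcB)⟩) with h | h
  · exact hcm (h ▸ hcB)
  · exact hcm (h.2.1 hcB)

/-- Deciding everything over `M` leaves comparisons with new parameters open. After ω rounds,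
parameters from stage `n` are settled at stage `n + 1`. -/
theorem exists_emb_infGeneric (hK : Inductive K) {M : Str L} (hM : M ∈ K) :
    ∃ N ∈ InfGeneric K, Nonempty (Emb M N) := by
  obtain ⟨lab, hl⟩ := exists_injective_ordinal M
  choose F hF f hf hd using fun A : {A : LabStr L // A.str ∈ K} => exists_decides hK A.1 A.2
  let A : ℕ → {A : LabStr L // A.str ∈ K} :=
    fun n => (fun A => ⟨F A, hF A⟩)^[n] ⟨⟨M, lab, hl⟩, hM⟩
  have hA : ∀ n, A (n + 1) = ⟨F (A n), hF (A n)⟩ := fun n => Function.iterate_succ_apply' _ _ _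
  have hmono : Monotone fun n : ULift.{u} ℕ => (A n.down).1 := by
    have : Monotone fun n => (A n).1 := monotone_nat_of_le_succ fun n => by
      rw [hA]
      exact ⟨f (A n), hf (A n)⟩
    exact fun m n h => this h
  obtain ⟨B, hB, g, hg, hr, hdense⟩ := LabStr.exists_union hK hmono fun n => (A n.down).2
  refine ⟨B.str, mem_infGeneric_of_dense hB g hr hdense fun n k p a => ?_, ⟨g ⟨0⟩⟩⟩
  obtain ⟨h, hh⟩ : F (A n.down) ≤ B := by
    have : (A (n.down + 1)).1 ≤ B := ⟨g ⟨n.down + 1⟩, hg _⟩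
    rwa [hA] at this
  have := (hd (A n.down) k p a).emb h
  -- The route through stage `n + 1` agrees with `g n` because label-preserving embeddings are
  -- unique.
  rwa [← Function.comp_assoc, ← Emb.coe_comp, (hh.comp (hf _)).coe_eq (hg n)] at this

/-! ### Generic structures -/

theorem exists_tuple_iff {X : Type*} {n : ℕ} {P : (Fin (n + 1) → X) → Prop} :
    (∃ c, P c) ↔ ∃ (c : Fin n → X) (b : X), P (Fin.snoc c b) :=
  ⟨fun ⟨c, h⟩ => ⟨Fin.init c, c (Fin.last n), by rwa [Fin.snoc_init_self]⟩,
    fun ⟨_, _, h⟩ => ⟨_, h⟩⟩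

/-- The prenex formula `inf_{x₁} ⋯ inf_{xₘ} p`. -/
def Prenex.infs {n : ℕ} : ∀ m : ℕ, Prenex L (n + m) → Prenex L n
  | 0, p => p
  | m + 1, p => Prenex.infs m (.inf p)

theorem forces_infs_lt_iff {n m : ℕ} {p : Prenex L (n + m)} {M : Str L} {a : Fin n → M} {r : I} :
    Forces K (p.infs m) M a .lt r ↔ ∃ c : Fin m → M, Forces K p M (Fin.append a c) .lt r := by
  induction m with
  | zero =>
    have : ∀ c : Fin 0 → M, Fin.append a c = a := fun c => by
      rw [Subsingleton.elim c Fin.elim0, Fin.append_elim0]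
      rfl
    simp only [this, exists_const]
    rfl
  | succ m ih =>
    rw [exists_tuple_iff]
    refine (ih (p := .inf p)).trans (exists_congr fun c => ?_)
    simp only [Fin.append_snoc]
    rfl

/-- If `M` forced the infimum above a value undercut in `N`, persistence would make `N`
inconsistent; so `M` forces it below a slightly larger value and contains a witness. -/
theorem existentiallyClosedIn_of_mem_infGeneric {M N : Str L} (hM : M ∈ InfGeneric K)
    (hN : N ∈ K) (f : Emb M N) : ExistentiallyClosedIn f := by
  intro n m φ hφ a
  refine le_antisymm (le_iInf fun b => le_of_forall_gt_imp_ge_of_dense fun s hs => ?_)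
    (le_iInf fun c => ?_)
  · have hs' : (φ.val N (Fin.append (f ∘ a) b) : ℝ) < s := hs
    set v := φ.val N (Fin.append (f ∘ a) b)
    have h0 := v.2.1
    have h1 := s.2.2
    -- In fifths of the gap from `v` to `s`: replacing `φ` by `ψ` costs one in `N` and one in `M`,
    -- and the comparison decided lies between marks 2 and 3.
    have hε : 0 < ((s : ℝ) - v) / 5 := by linarith
    obtain ⟨ψ, hψ, hd⟩ := hφ.exists_restricted hε
    have key : ∀ k : ℝ, 1 ≤ k → k ≤ 4 → (v : ℝ) + k * ((s - v) / 5) ∈ I := fun k hk hk' =>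
      ⟨by nlinarith, by nlinarith⟩
    let t : ℝ → I := fun k => Set.projIcc 0 1 zero_le_one ((v : ℝ) + k * ((s - v) / 5))
    have ht : ∀ k : ℝ, 1 ≤ k → k ≤ 4 → (t k : ℝ) = v + k * ((s - v) / 5) := fun k hk hk' => by
      simp only [t]
      rw [Set.projIcc_of_mem _ (key k hk hk')]
    have hNf : Forces K (Prenex.infs m (.qf ψ hψ)) N (f ∘ a) .lt (t 2) := by
      refine forces_infs_lt_iff.2 ⟨b, ?_⟩
      have := hd N (Fin.append (f ∘ a) b)
      rw [Subtype.dist_eq, Real.dist_eq, abs_le] at this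
      show ψ.val N (Fin.append (f ∘ a) b) < t 2
      rw [← Subtype.coe_lt_coe, ht 2 (by norm_num) (by norm_num)]
      linarith
    have hlt : t 2 < t 3 := by
      rw [← Subtype.coe_lt_coe, ht 2 (by norm_num) (by norm_num), ht 3 (by norm_num) (by norm_num)]
      linarith
    rcases (mem_infGeneric_iff.1 hM).2 n (Prenex.infs m (.qf ψ hψ)) a _ _ hlt with h | h
    · obtain ⟨c, hc⟩ := forces_infs_lt_iff.1 h
      refine (iInf_le _ c).trans ?_
      have := hd M (Fin.append a c)
      rw [Subtype.dist_eq, Real.dist_eq, abs_le] at this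
      have hc' : (ψ.val M (Fin.append a c) : ℝ) < t 3 := hc
      rw [ht 3 (by norm_num) (by norm_num)] at hc'
      rw [← Subtype.coe_le_coe]
      linarith
    · exact (hNf.not_lt_and_gt hN (h.gt_emb f)).elim
  · refine (iInf_le _ (f ∘ c)).trans (le_of_eq ?_)
    rw [← hφ.val_emb f]
    congr 1
    funext i
    induction i using Fin.addCases <;> simp

/-- In a generic structure, the forcing values of a sentence are its value. -/
theorem upperValue_eq_val {M : Str L} (hM : M ∈ InfGeneric K) {n : ℕ} (p : Prenex L n)
    (a : Fin n → M) : upperValue K p M a = p.val M a := by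
  induction p with
  | qf φ h =>
    exact le_antisymm (le_of_forall_gt_imp_ge_of_dense fun r hr => sInf_le hr)
      (le_sInf fun r hr => le_of_lt hr)
  | inf p ih =>
    rw [Prenex.val_inf]
    simp only [← ih]
    refine le_antisymm (le_iInf fun b => sInf_le_sInf fun r hr => ⟨b, hr⟩) (le_sInf ?_)
    rintro r ⟨b, hb⟩
    exact (iInf_le _ b).trans (sInf_le hb)
  | sup p ih =>
    -- For `sup` it is the clause for `>` that provides witnesses, so genericity is used to pass to
    -- lower values.
    rw [Prenex.val_sup, ← hM.2]
    simp only [← ih, ← hM.2]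
    refine le_antisymm (sSup_le ?_) (iSup_le fun b => sSup_le_sSup fun r hr => ⟨b, hr⟩)
    rintro r ⟨b, hb⟩
    exact (le_sSup hb).trans (le_iSup (fun b => lowerValue K p M (Fin.snoc a b)) b)

theorem Emb.isElementary_of_prenex {M N : Str L} (f : Emb M N)
    (h : ∀ (n : ℕ) (p : Prenex L n) (a : Fin n → M), p.val N (f ∘ a) = p.val M a) :
    f.IsElementary := by
  intro n φ a
  refine eq_of_forall_dist_le fun ε hε => ?_
  obtain ⟨p, hp⟩ := φ.exists_prenex (half_pos hε)
  have h1 := hp N (f ∘ a)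
  have h2 := hp M a
  rw [h n p a] at h1
  exact (dist_triangle_right _ _ _).trans ((add_le_add h1 h2).trans_eq (add_halves ε))

/-- Persistence bounds the upper value in `N` by that in `M`, and the lower values the other way
round; genericity of both closes the circle. -/
theorem modelComplete_infGeneric : ModelComplete (InfGeneric K) := by
  intro M hM N hN f
  refine f.isElementary_of_prenex fun n p a => ?_
  rw [← upperValue_eq_val hM, ← upperValue_eq_val hN]
  refine le_antisymm (sInf_le_sInf fun r hr => Forces.lt_emb f hr) ?_
  rw [← hM.2, ← hN.2]
  exact sSup_le_sSup fun r hr => Forces.gt_emb f hr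

/-- In the members of a model-consistent and model-complete subclass, forcing is truth. -/
theorem IsModelCompleteSubclass.forces_iff {C : Set (Str L)} (hC : IsModelCompleteSubclass K C)
    {n : ℕ} (p : Prenex L n) {M : Str L} (hM : M ∈ C) (a : Fin n → M) (r : I) :
    (Forces K p M a .lt r ↔ p.val M a < r) ∧ (Forces K p M a .gt r ↔ r < p.val M a) := by
  obtain ⟨hCK, hcons, hcomp⟩ := hC
  induction p generalizing M r with
  | qf φ h => exact ⟨Iff.rfl, Iff.rfl⟩
  | inf p ih =>
    constructor
    · rw [Prenex.val_inf, iInf_lt_iff]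
      exact exists_congr fun b => (ih hM _ _).1
    · constructor
      · rintro ⟨s, hs, h⟩
        refine hs.trans_le (le_iInf fun b => le_of_not_gt fun hb => h ?_)
        exact ⟨M, hCK hM, Emb.refl M, b, (ih hM _ _).1.2 hb⟩
      · intro hr
        -- The threshold is the true value itself. A witness below it in some `N` passes to a `P` in
        -- `C` above `N`, where elementarity of `M` in `P` gives the infimum that same value.
        refine ⟨_, hr, ?_⟩
        rintro ⟨N, hN, f, b, hb⟩
        obtain ⟨P, hP, ⟨g⟩⟩ := hcons N hN
        have h1 := hb.lt_emb g
        rw [Fin.comp_snoc] at h1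
        have h2 := (ih hP _ _).1.1 h1
        have h3 : p.inf.val P (g.comp f ∘ a) = p.inf.val M a :=
          hcomp M hM P hP (g.comp f) _ p.inf.toFormula a
        rw [← h3] at h2
        exact h2.not_ge (iInf_le (fun b => p.val P (Fin.snoc (g.comp f ∘ a) b)) (g b))
  | sup p ih =>
    constructor
    · constructor
      · rintro ⟨s, hs, h⟩
        refine lt_of_le_of_lt (iSup_le fun b => le_of_not_gt fun hb => h ?_) hs
        exact ⟨M, hCK hM, Emb.refl M, b, (ih hM _ _).2.2 hb⟩
      · intro hr
        refine ⟨_, hr, ?_⟩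
        rintro ⟨N, hN, f, b, hb⟩
        obtain ⟨P, hP, ⟨g⟩⟩ := hcons N hN
        have h1 := hb.gt_emb g
        rw [Fin.comp_snoc] at h1
        have h2 := (ih hP _ _).2.1 h1
        have h3 : p.sup.val P (g.comp f ∘ a) = p.sup.val M a :=
          hcomp M hM P hP (g.comp f) _ p.sup.toFormula a
        rw [← h3] at h2
        exact h2.not_ge (le_iSup (fun b => p.val P (Fin.snoc (g.comp f ∘ a) b)) (g b))
    · rw [Prenex.val_sup, lt_iSup_iff]
      exact exists_congr fun b => (ih hM _ _).2

theorem IsModelCompleteSubclass.subset_infGeneric {C : Set (Str L)}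
    (hC : IsModelCompleteSubclass K C) : C ⊆ InfGeneric K := fun M hM =>
  mem_infGeneric_iff.2 ⟨hC.1 hM, fun n p a r r' hr => by
    rw [(hC.forces_iff p hM a r').1, (hC.forces_iff p hM a r).2]
    exact (lt_or_ge _ _).imp id hr.trans_le⟩

theorem isGreatest_infGeneric (hK : Inductive K) :
    IsGreatest {C | IsModelCompleteSubclass K C} (InfGeneric K) :=
  ⟨⟨fun _ h => h.1, fun _ hM => exists_emb_infGeneric hK hM, modelComplete_infGeneric⟩,
    fun _ hC => hC.subset_infGeneric⟩

end ContLogic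

theorem mainTheorem9 (L : ContLogic.Signature.{u}) (K : Set (ContLogic.Str L))
    (hK : ContLogic.Inductive K) :
    (∀ M ∈ K, ∃ N ∈ ContLogic.InfGeneric K, Nonempty (ContLogic.Emb M N)) ∧
    (∀ M ∈ ContLogic.InfGeneric K, ContLogic.IsEC K M) ∧
    ContLogic.Inductive (ContLogic.InfGeneric K) ∧
    IsGreatest {C | ContLogic.IsModelCompleteSubclass K C} (ContLogic.InfGeneric K) ∧
    (∀ C : Set (ContLogic.Str L),
      Maximal (ContLogic.IsModelCompleteSubclass K) C ↔ C = ContLogic.InfGeneric K) := by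
  have hG := ContLogic.isGreatest_infGeneric hK
  refine ⟨fun M hM => ContLogic.exists_emb_infGeneric hK hM,
    fun M hM => ⟨hM.1, fun N hN f =>
      ContLogic.existentiallyClosedIn_of_mem_infGeneric hM hN f⟩,
    ContLogic.inductive_infGeneric hK, hG, fun C => ⟨fun hC => ?_, ?_⟩⟩
  · exact (hG.2 hC.prop).antisymm (hC.2 hG.1 (hG.2 hC.prop))
  · rintro rfl
    exact ⟨hG.1, fun C hC _ => hG.2 hC⟩
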